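/- Let $n\ge 1$, and let $f:\mathbb{R}^n\to\mathbb{R}$ be continuously differentiable and bounded below by $f^*\in\mathbb{R}$, with $\nabla f$ Lipschitz continuous with constant $L_f\ge 0$. The values of $f$ are only available through unbiased noisy observations $F(x,\xi)$, with $E_\xi[F(x,\xi)]=f(x)$ for every $x$. A sequential hypothesis test draws independent observations $Y^1,Y^2,\dots$ of a random variable $Y$ with mean $\mu$, stops after a number $m$ of observations given by a stopping rule, and then accepts either $H_0:\mu\le 0$ or $H_1:\mu>0$. It ends properly if $P(m<\infty)=1$. It is $C$-accurate if $P(H_1\text{ is accepted})\le\frac12$ when $\mu\le 0$, and $P(H_0\text{ is accepted})\le C/\mu$ when $\mu>0$. Let $c>0$, $0<\theta<1<\gamma$, $\delta_0>0$ and $x_0\in\mathbb{R}^n$. Probabilistic-descent direct search starts from $X_0=x_0$, $\Delta_0=\delta_0$. At each iteration $k=0,1,2,\dots$ it draws $D_k$ uniformly from the unit sphere, independently of the past. It then performs, with fresh observations, a $C_k$-accurate sequential test that ends properly, where $C_k=\frac{c\Delta_k^2(1-\theta^2)}{2(\gamma^2-\theta^2)}$, for the random variable $Y_k=c\Delta_k^2-\big(F(X_k,\xi^x)-F(X_k+\Delta_kD_k,\xi^d)\big)$,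 where $\xi^x,\xi^d$ are independent. If $H_0$ is accepted, then $X_{k+1}=X_k+\Delta_kD_k$ and $\Delta_{k+1}=\gamma\Delta_k$; otherwise $X_{k+1}=X_k$ and $\Delta_{k+1}=\theta\Delta_k$. For $\epsilon>0$ let $T_\epsilon=\inf\{k\ge 0:\|\nabla f(X_k)\|\le\epsilon\}$ and $\delta_\epsilon=\frac{2}{7L_f+14c}\,\frac{\epsilon}{\sqrt n}$. Assume $3\log\gamma+11\log\theta>0$. (a) If $\theta\,\delta_\epsilon\le\delta_0$ (which holds whenever $\epsilon$ is small enough), then $$E[T_\epsilon]\le 1+\frac{14\log\gamma}{3\log\gamma+11\log\theta}\cdot\frac{(\gamma^2-\theta^2)(f(x_0)-f^*)+c\,\delta_0^2}{\frac c2(1-\theta^2)\theta^2}\cdot\frac{(7L_f+14c)^2}{4}\cdot\frac{n}{\epsilon^2}.$$ (b) $E[T_\epsilon]=O(n/\epsilon^2)$: for every $M$ there is a constant $K$, depending only on $c,\theta,\gamma,\delta_0,L_f$ and $M$, such that $E[T_\epsilon]\le K\,n/\epsilon^2$ for all $n\ge1$, all such $f$, $f^*$, $x_0$ with $f(x_0)-f^*\le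 M$, all oracles and tests as above, and all $\epsilon>0$. -/

import Mathlib

open MeasureTheory ProbabilityTheory Set
open scoped ENNReal NNReal Gradient

noncomputable section

/-! ### Sequential hypothesis tests for the sign of a mean -/

/-- A sequential hypothesis test.  A sample is an infinite sequence `y` of observations;
`sampleSize y` is the number of observations used (`⊤` if the test never ends) and, when the test ends,
`y ∈ decideH0` means that the decision is `H₀ : μ ≤ 0`, and `y ∉ decideH0` that it is `H₁ : μ > 0`.
Both the stopping rule and the decision depend only on the observations used. -/
structure SequentialTest where
  sampleSize : (ℕ → ℝ) → ℕ∞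
  decideH0 : Set (ℕ → ℝ)
  measurable_sampleSize : Measurable sampleSize
  measurableSet_decideH0 : MeasurableSet decideH0
  sampleSize_eq_of_agree : ∀ y z : ℕ → ℝ, (∀ i : ℕ, (i : ℕ∞) < sampleSize y → y i = z i) →
    sampleSize z = sampleSize y
  decide_iff_of_agree : ∀ y z : ℕ → ℝ, (∀ i : ℕ, (i : ℕ∞) < sampleSize y → y i = z i) →
    (z ∈ decideH0 ↔ y ∈ decideH0)

/-- The acceptance region of `H₀`. -/
def SequentialTest.acceptsH0 (T : SequentialTest) : Set (ℕ → ℝ) :=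
  {y | T.sampleSize y < ⊤ ∧ y ∈ T.decideH0}

/-- The acceptance region of `H₁`. -/
def SequentialTest.acceptsH1 (T : SequentialTest) : Set (ℕ → ℝ) :=
  {y | T.sampleSize y < ⊤ ∧ y ∉ T.decideH0}

/-- The law of a sequence of independent observations with common law `ν`. -/
def iidLaw {α : Type*} [MeasurableSpace α] (ν : Measure α) : Measure (ℕ → α) :=
  Measure.infinitePi (fun _ : ℕ => ν)

/-- The test ends properly on observations with law `ν`: it ends almost surely. -/
def SequentialTest.EndsProperly (T : SequentialTest) (ν : Measure ℝ) : Prop :=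
  ∀ᵐ y ∂(iidLaw ν), T.sampleSize y < ⊤

/-- The test is `C`-accurate on observations with law `ν`, whose mean is `μ = ∫ y ∂ν`: if `μ ≤ 0`
then `H₁` is accepted with probability at most `1 / 2`, and if `μ > 0` then `H₀` is accepted with
probability at most `C / μ`. -/
def SequentialTest.IsAccurate (T : SequentialTest) (C : ℝ) (ν : Measure ℝ) : Prop :=
  ((∫ y, y ∂ν) ≤ 0 → (iidLaw ν).real T.acceptsH1 ≤ 1 / 2) ∧
  (0 < (∫ y, y ∂ν) → (iidLaw ν).real T.acceptsH0 ≤ C / ∫ y, y ∂ν)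

/-! ### The stochastic zeroth-order oracle -/

/-- The Euclidean space `ℝⁿ`. -/
abbrev Vec (n : ℕ) : Type := EuclideanSpace ℝ (Fin n)

/-- The unit sphere of `ℝⁿ`. -/
abbrev USphere (n : ℕ) : Type := Metric.sphere (0 : Vec n) 1

/-- The uniform distribution on the unit sphere: the normalized surface measure. -/
def uniformSphere (n : ℕ) : Measure (USphere n) :=
  ((volume : Measure (Vec n)).toSphere univ)⁻¹ • (volume : Measure (Vec n)).toSphere

/-- `F x ξ`, where `ξ` has law `ρ`, is an unbiased noisy observation of `f x`. -/
structure IsUnbiasedOracle {n : ℕ} {Ξ : Type*} [MeasurableSpace Ξ]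
    (f : Vec n → ℝ) (F : Vec n → Ξ → ℝ) (ρ : Measure Ξ) : Prop where
  isProbabilityMeasure : IsProbabilityMeasure ρ
  measurable : Measurable (fun p : Vec n × Ξ => F p.1 p.2)
  integrable : ∀ x, Integrable (F x) ρ
  integral_eq : ∀ x, ∫ ξ, F x ξ ∂ρ = f x

/-- The tested statistic `Y = c δ² - (F(x, ξˣ) - F(x + δ d, ξᵈ))` as a function of the pair of
noises `(ξˣ, ξᵈ)`. -/
def decreaseStat {n : ℕ} {Ξ : Type*} (F : Vec n → Ξ → ℝ) (c : ℝ) (x : Vec n) (δ : ℝ)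
    (d : USphere n) (p : Ξ × Ξ) : ℝ :=
  c * δ ^ 2 - (F x p.1 - F (x + δ • (d : Vec n)) p.2)

/-- The law of the statistic `Y` when `ξˣ` and `ξᵈ` are independent with law `ρ`. -/
def decreaseLaw {n : ℕ} {Ξ : Type*} [MeasurableSpace Ξ] (F : Vec n → Ξ → ℝ) (ρ : Measure Ξ)
    (c : ℝ) (x : Vec n) (δ : ℝ) (d : USphere n) : Measure ℝ :=
  (ρ.prod ρ).map (decreaseStat F c x δ d)

/-! ### Probabilistic-descent direct search with sequential tests -/

/-- The scalar parameters of the algorithm. -/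
structure SearchParams where
  c : ℝ
  θ : ℝ
  γ : ℝ
  δ₀ : ℝ
  c_pos : 0 < c
  θ_pos : 0 < θ
  θ_lt_one : θ < 1
  one_lt_γ : 1 < γ
  δ₀_pos : 0 < δ₀

/-- The accuracy `c δ² (1 - θ²) / (2 (γ² - θ²))` required of the test at step size `δ`. -/
def SearchParams.accuracy (P : SearchParams) (δ : ℝ) : ℝ :=
  P.c * δ ^ 2 * ((1 - P.θ ^ 2) / (2 * (P.γ ^ 2 - P.θ ^ 2)))

/-- A choice of the sequential test to be performed at iteration `k`, current point `x`, current
step size `δ` and direction `d`. -/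
abbrev TestRule (n : ℕ) : Type := ℕ → Vec n → ℝ → USphere n → SequentialTest

/-- Every test of the rule ends properly and has the accuracy required by the algorithm, for the
hypothesis test problem about the statistic `Y` to which the algorithm applies it. -/
structure TestRule.IsAdmissible {n : ℕ} {Ξ : Type*} [MeasurableSpace Ξ] (test : TestRule n)
    (P : SearchParams) (F : Vec n → Ξ → ℝ) (ρ : Measure Ξ) : Prop where
  endsProperly : ∀ (k : ℕ) (x : Vec n) (δ : ℝ) (d : USphere n), 0 < δ →
    (test k x δ d).EndsProperly (decreaseLaw F ρ P.c x δ d)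
  isAccurate : ∀ (k : ℕ) (x : Vec n) (δ : ℝ) (d : USphere n), 0 < δ →
    (test k x δ d).IsAccurate (P.accuracy δ) (decreaseLaw F ρ P.c x δ d)
  measurable : ∀ k : ℕ, MeasurableSet
    {q : (Vec n × ℝ × USphere n) × (ℕ → ℝ) | q.2 ∈ (test k q.1.1 q.1.2.1 q.1.2.2).acceptsH0}

section Algorithm

variable {n : ℕ} {Ξ Ω : Type*}

/-- The candidate point is accepted: the test at iteration `k`, point `x`, step size `δ` and
direction `d`, fed with the observations obtained from the noise pairs `ξ l = (ξˣ_l, ξᵈ_l)`,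
accepts `H₀`. -/
def stepAccepted (P : SearchParams) (F : Vec n → Ξ → ℝ) (test : TestRule n) (k : ℕ)
    (x : Vec n) (δ : ℝ) (d : USphere n) (ξ : ℕ → Ξ × Ξ) : Prop :=
  (fun l => decreaseStat F P.c x δ d (ξ l)) ∈ (test k x δ d).acceptsH0

open Classical in
/-- The state `(X_k, Δ_k)` of the algorithm, started at `x₀` and step size `δ₀`, with directions
`D k` and with noise pairs `ξ k l`, where `l` numbers the observations within iteration `k`. -/
def searchState (P : SearchParams) (F : Vec n → Ξ → ℝ) (test : TestRule n) (x₀ : Vec n)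
    (D : ℕ → Ω → USphere n) (ξ : ℕ → Ω → ℕ → Ξ × Ξ) : ℕ → Ω → Vec n × ℝ
  | 0, _ => (x₀, P.δ₀)
  | k + 1, ω =>
    let s := searchState P F test x₀ D ξ k ω
    if stepAccepted P F test k s.1 s.2 (D k ω) (ξ k ω) then
      (s.1 + s.2 • (D k ω : Vec n), P.γ * s.2)
    else (s.1, P.θ * s.2)

/-- `A_k`: the null hypothesis is accepted at iteration `k`. -/
def searchAccepts (P : SearchParams) (F : Vec n → Ξ → ℝ) (test : TestRule n) (x₀ : Vec n)
    (D : ℕ → Ω → USphere n) (ξ : ℕ → Ω → ℕ → Ξ × Ξ) (k : ℕ) (ω : Ω) : Prop :=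
  stepAccepted P F test k (searchState P F test x₀ D ξ k ω).1 (searchState P F test x₀ D ξ k ω).2
    (D k ω) (ξ k ω)

/-- The σ-algebra `ℱ_k` generated by `D_0, …, D_{k-1}` and `A_0, …, A_{k-1}`. -/
abbrev pastSigma (P : SearchParams) (F : Vec n → Ξ → ℝ) (test : TestRule n) (x₀ : Vec n)
    (D : ℕ → Ω → USphere n) (ξ : ℕ → Ω → ℕ → Ξ × Ξ) (k : ℕ) : MeasurableSpace Ω :=
  ⨆ j : ℕ, ⨆ _ : j < k, MeasurableSpace.comap (D j) inferInstance ⊔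
    MeasurableSpace.comap (searchAccepts P F test x₀ D ξ j) ⊤

/-- The σ-algebra `ℱ_{k+1/2}` generated by `D_0, …, D_k` and `A_0, …, A_{k-1}`. -/
abbrev midSigma (P : SearchParams) (F : Vec n → Ξ → ℝ) (test : TestRule n) (x₀ : Vec n)
    (D : ℕ → Ω → USphere n) (ξ : ℕ → Ω → ℕ → Ξ × Ξ) (k : ℕ) : MeasurableSpace Ω :=
  pastSigma P F test x₀ D ξ k ⊔ MeasurableSpace.comap (D k) inferInstance

/-- The random inputs of a run of the algorithm: at iteration `k` the direction is drawn uniformly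
from the unit sphere, independently of the past, and then fresh independent noises with law `ρ`
are drawn, independently of the past and of the direction. -/
structure IsSearchRun [MeasurableSpace Ξ] [MeasurableSpace Ω] (P : SearchParams)
    (F : Vec n → Ξ → ℝ) (ρ : Measure Ξ) (test : TestRule n) (x₀ : Vec n)
    (D : ℕ → Ω → USphere n) (ξ : ℕ → Ω → ℕ → Ξ × Ξ) (μ : Measure Ω) : Prop where
  measurable_dir : ∀ k, Measurable (D k)
  measurable_noise : ∀ k, Measurable (ξ k)
  law_dir : ∀ k, μ.map (D k) = uniformSphere n
  law_noise : ∀ k, μ.map (ξ k) = iidLaw (ρ.prod ρ)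
  indep_dir : ∀ k, Indep (pastSigma P F test x₀ D ξ k)
    (MeasurableSpace.comap (D k) inferInstance) μ
  indep_noise : ∀ k, Indep (midSigma P F test x₀ D ξ k)
    (MeasurableSpace.comap (ξ k) inferInstance) μ

/-- `T_ε = inf {k ≥ 0 : ‖∇f(X_k)‖ ≤ ε}`, which is `∞` if there is no such `k`. -/
def hittingIteration (P : SearchParams) (f : Vec n → ℝ) (F : Vec n → Ξ → ℝ) (test : TestRule n)
    (x₀ : Vec n) (D : ℕ → Ω → USphere n) (ξ : ℕ → Ω → ℕ → Ξ × Ξ) (ε : ℝ) (ω : Ω) : ℝ≥0∞ :=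
  ⨅ (k : ℕ) (_ : ‖∇ f (searchState P F test x₀ D ξ k ω).1‖ ≤ ε), (k : ℝ≥0∞)

end Algorithm

/-- The step-size threshold `δ_ε = 2 ε / ((7 L + 14 c) √n)`. -/
def SearchParams.threshold (P : SearchParams) (L : ℝ≥0) (n : ℕ) (ε : ℝ) : ℝ :=
  2 / (7 * (L : ℝ) + 14 * P.c) * (ε / √(n : ℝ))

end

/-! Two estimates are played against each other. (1) Steps cannot be large often. For `lyapunov`,
f(x) + c δ²/(γ² - θ²), a rejection lowers the value by exactly 2C_k, while an acceptance adds the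
mean of Y_k to this change. Accuracy of the test gives P(accept) · E[Y_k] ≤ C_k, so the expected
value drops by at least E[C_k] per iteration (`IsSearchRun.integral_lyapunov_succ_le`). As f is
bounded below, ∑ E[Δ_k²] is finite, and Chebyshev bounds the expected number of visits of Δ_k above
θ δ_ε. (2) Steps cannot stay small while ‖∇f‖ > ε. A uniform direction is a good descent direction
with probability at least 3/7. Along it a step of length at most δ_ε decreases f by c δ², so the
test accepts with probability at least 1/2. The chance of acceptance is thus at least 3/14
(`IsSearchRun.three_fourteenths_mul_le`), and log Δ_k has mean drift at least d = (3 log γ + 11 log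
θ)/14 > 0. A pathwise inequality (`sum_log_gain_le_visits`) charges the upward drift to visits above
θ δ_ε: d · E[T_ε] is at most log γ times the expected number of visits, which is (a). For (b), a
large ε is reduced to the ε₁ with θ δ_{ε₁} = δ₀, using ‖∇f(x₀)‖² ≤ 2L(f(x₀) - f*). -/

/-! ### Caps of the sphere: a uniform direction is a descent direction with probability at least
3/7. -/

section UniformDirection

open scoped Pointwise

/-- Log-convexity of Γ at the midpoint of x and x + 1. -/
theorem Real.Gamma_add_half_le {x : ℝ} (hx : 0 < x) :
    Real.Gamma (x + 1 / 2) ≤ √x * Real.Gamma x := by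
  have h := Real.Gamma_mul_add_mul_le_rpow_Gamma_mul_rpow_Gamma hx (by linarith : 0 < x + 1)
    (by norm_num : (0 : ℝ) < 1 / 2) (by norm_num : (0 : ℝ) < 1 / 2) (by norm_num)
  have hG := Real.Gamma_pos_of_pos hx
  rw [Real.Gamma_add_one hx.ne', ← Real.sqrt_eq_rpow, ← Real.sqrt_eq_rpow,
    Real.sqrt_mul hx.le] at h
  calc Real.Gamma (x + 1 / 2) = Real.Gamma (1 / 2 * x + 1 / 2 * (x + 1)) := by congr 1; ring
    _ ≤ _ := h
    _ = √x * (√(Real.Gamma x) * √(Real.Gamma x)) := by ring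
    _ = _ := by rw [Real.mul_self_sqrt hG.le]

theorem two_div_sqrt_mul_Gamma_le (m : ℕ) :
    2 / √((m : ℝ) + 1) * Real.Gamma (((m : ℝ) + 1) / 2 + 1) ≤
      √Real.pi * Real.Gamma ((m : ℝ) / 2 + 1) := by
  -- For m = 0 there is equality, and the estimate through `Real.Gamma_add_half_le` would need 4 ≤
  -- π.
  rcases Nat.eq_zero_or_pos m with rfl | hm
  · have : Real.Gamma ((0 + 1) / 2 + 1) = 1 / 2 * √Real.pi := by
      rw [zero_add, Real.Gamma_add_one (by norm_num), Real.Gamma_one_half_eq]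
    rw [Nat.cast_zero, this, zero_div, zero_add, Real.Gamma_one]
    apply le_of_eq; simp
  · have hm1 : (1 : ℝ) ≤ m := by exact_mod_cast hm
    have h := Real.Gamma_add_half_le (x := (m : ℝ) / 2 + 1) (by positivity)
    have e : ((m : ℝ) + 1) / 2 + 1 = (m : ℝ) / 2 + 1 + 1 / 2 := by ring
    have hG := Real.Gamma_pos_of_pos (by positivity : 0 < (m : ℝ) / 2 + 1)
    have hs : 2 / √((m : ℝ) + 1) * √((m : ℝ) / 2 + 1) ≤ √Real.pi := by
      rw [div_mul_eq_mul_div, div_le_iff₀ (by positivity), ← Real.sqrt_mul Real.pi_pos.le]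
      apply Real.le_sqrt_of_sq_le
      rw [mul_pow, Real.sq_sqrt (by positivity)]
      nlinarith [Real.pi_gt_three]
    rw [e]
    calc _ ≤ 2 / √((m : ℝ) + 1) * (√((m : ℝ) / 2 + 1) * Real.Gamma ((m : ℝ) / 2 + 1)) := by
          gcongr
      _ = 2 / √((m : ℝ) + 1) * √((m : ℝ) / 2 + 1) * Real.Gamma ((m : ℝ) / 2 + 1) := by ring
      _ ≤ _ := by gcongr

theorem volume_unitBall_vec (m : ℕ) : volume (Metric.ball (0 : Vec m) 1) =
    ENNReal.ofReal (√Real.pi ^ m / Real.Gamma ((m : ℝ) / 2 + 1)) := by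
  rcases Nat.eq_zero_or_pos m with rfl | hm
  · have : Metric.ball (0 : Vec 0) 1 = univ := by
      ext x; simp [Subsingleton.elim x 0]
    have h := (PiLp.volume_preserving_ofLp (Fin 0)).measure_preimage
      MeasurableSet.univ.nullMeasurableSet
    rw [preimage_univ] at h
    rw [this, h, volume_pi, Measure.pi_univ]
    simp
  · have : Nonempty (Fin m) := ⟨⟨0, hm⟩⟩
    simp [EuclideanSpace.volume_ball]

theorem volume_unitBall_vec_le (m : ℕ) :
    ENNReal.ofReal (2 * (1 / (7 * √((m : ℝ) + 1)))) * volume (Metric.ball (0 : Vec m) 1) ≤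
      ENNReal.ofReal (1 / 7) * volume (Metric.ball (0 : Vec (m + 1)) 1) := by
  rw [volume_unitBall_vec, volume_unitBall_vec, ← ENNReal.ofReal_mul (by positivity),
    ← ENNReal.ofReal_mul (by positivity)]
  apply ENNReal.ofReal_le_ofReal
  have h := two_div_sqrt_mul_Gamma_le m
  have h1 := Real.Gamma_pos_of_pos (by positivity : 0 < (m : ℝ) / 2 + 1)
  have h2 := Real.Gamma_pos_of_pos (by positivity : 0 < ((m : ℝ) + 1) / 2 + 1)
  push_cast
  have : 2 / √((m : ℝ) + 1) * (√Real.pi ^ m / Real.Gamma ((m : ℝ) / 2 + 1)) ≤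
      √Real.pi ^ (m + 1) / Real.Gamma (((m : ℝ) + 1) / 2 + 1) := by
    rw [mul_div_assoc', div_le_div_iff₀ h1 h2, pow_succ]
    have := mul_le_mul_of_nonneg_left h (by positivity : 0 ≤ √Real.pi ^ m)
    linarith
  calc _ = 1 / 7 * (2 / √((m : ℝ) + 1) * (√Real.pi ^ m / Real.Gamma ((m : ℝ) / 2 + 1))) := by
        field_simp
    _ ≤ _ := by gcongr

/-- In an orthonormal basis starting with v, the slab of the ball lies in the cylinder (-a, a) ×
(unit ball of one dimension less). -/
theorem volume_ball_inter_slab_le {m : ℕ} (v : Vec (m + 1)) (hv : ‖v‖ = 1) (a : ℝ) :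
    volume {x : Vec (m + 1) | ‖x‖ < 1 ∧ |inner ℝ v x| < a} ≤
      ENNReal.ofReal (2 * a) * volume (Metric.ball (0 : Vec m) 1) := by
  obtain ⟨b, hb⟩ := Orthonormal.exists_orthonormalBasis_extension_of_card_eq (𝕜 := ℝ)
    (E := Vec (m + 1)) (ι := Fin (m + 1)) (by simp) (v := fun _ => v) (s := {0}) (by
      constructor
      · intro i; simpa using hv
      · intro i j hij; exact absurd (Subsingleton.elim i j) hij)
  have hb0 : b 0 = v := hb 0 rfl
  have e1 := b.measurePreserving_repr
  have e2 := PiLp.volume_preserving_ofLp (Fin (m + 1))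
  have e3 := volume_preserving_piFinSuccAbove (fun _ : Fin (m + 1) => ℝ) 0
  have e := e3.comp (e2.comp e1)
  set S : Set (ℝ × (Fin m → ℝ)) := Ioo (-a) a ×ˢ (WithLp.toLp 2 ⁻¹' Metric.ball (0 : Vec m) 1)
  have hm : MeasurableSet (WithLp.toLp 2 ⁻¹' Metric.ball (0 : Vec m) 1) :=
    (PiLp.volume_preserving_toLp (Fin m)).measurable measurableSet_ball
  have hS : MeasurableSet S := measurableSet_Ioo.prod hm
  calc volume {x : Vec (m + 1) | ‖x‖ < 1 ∧ |inner ℝ v x| < a}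
      ≤ volume (_ ⁻¹' S) := by
        apply measure_mono
        rintro x ⟨hx, hxa⟩
        have h0 : b.repr x 0 = inner ℝ v x := by rw [b.repr_apply_apply, hb0]
        refine ⟨?_, ?_⟩
        · have : b.repr x 0 ∈ Ioo (-a) a := by rw [h0]; exact abs_lt.1 hxa
          simpa using this
        · simp only [mem_preimage, mem_ball_zero_iff]
          refine lt_of_le_of_lt ?_ hx
          rw [← b.repr.norm_map x, EuclideanSpace.norm_eq, EuclideanSpace.norm_eq]
          apply Real.sqrt_le_sqrt
          rw [Fin.sum_univ_succ (n := m)]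
          exact le_add_of_nonneg_left (by positivity)
    _ = volume S := e.measure_preimage hS.nullMeasurableSet
    _ = volume (Ioo (-a) a) * volume (WithLp.toLp 2 ⁻¹' Metric.ball (0 : Vec m) 1) :=
        Measure.prod_prod _ _
    _ = _ := by
        rw [(PiLp.volume_preserving_toLp (Fin m)).measure_preimage
          measurableSet_ball.nullMeasurableSet, Real.volume_Ioo]
        congr 2; ring

instance uniformSphere.instIsProbabilityMeasure (m : ℕ) :
    IsProbabilityMeasure (uniformSphere (m + 1)) := by
  constructor
  have h : (volume : Measure (Vec (m + 1))).toSphere ≠ 0 := Measure.toSphere_ne_zero _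
  rw [uniformSphere, Measure.smul_apply, smul_eq_mul]
  exact ENNReal.inv_mul_cancel (Measure.measure_univ_ne_zero.2 h) (measure_ne_top _ _)

/-- The dimension factor of the surface measure cancels in the normalization, leaving the share of
the ball filled by the cone over s. -/
theorem uniformSphere_apply {m : ℕ} {s : Set (USphere (m + 1))} (hs : MeasurableSet s) :
    uniformSphere (m + 1) s = (volume (Metric.ball (0 : Vec (m + 1)) 1))⁻¹ *
      volume (Ioo (0 : ℝ) 1 • ((↑) '' s : Set (Vec (m + 1)))) := by
  have hn : ((Module.finrank ℝ (Vec (m + 1)) : ℕ) : ℝ≥0∞) ≠ 0 := by simp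
  have hn' : ((Module.finrank ℝ (Vec (m + 1)) : ℕ) : ℝ≥0∞) ≠ ⊤ := ENNReal.natCast_ne_top _
  rw [uniformSphere, Measure.smul_apply, smul_eq_mul, Measure.toSphere_apply_univ,
    Measure.toSphere_apply' _ hs, ENNReal.mul_inv (Or.inl hn) (Or.inl hn')]
  calc _ = (((Module.finrank ℝ (Vec (m + 1)) : ℕ) : ℝ≥0∞)⁻¹ *
        ((Module.finrank ℝ (Vec (m + 1)) : ℕ) : ℝ≥0∞)) *
        ((volume (Metric.ball (0 : Vec (m + 1)) 1))⁻¹ *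
          volume (Ioo (0 : ℝ) 1 • ((↑) '' s : Set (Vec (m + 1))))) := by ring
    _ = _ := by rw [ENNReal.inv_mul_cancel hn hn', one_mul]

theorem uniformSphere_neg {m : ℕ} {s : Set (USphere (m + 1))} (hs : MeasurableSet s) :
    uniformSphere (m + 1) (Neg.neg ⁻¹' s) = uniformSphere (m + 1) s := by
  rw [uniformSphere_apply hs, uniformSphere_apply (continuous_neg.measurable hs),
    ← Measure.measure_neg volume (Ioo (0 : ℝ) 1 • ((↑) '' s : Set (Vec (m + 1))))]
  congr 2
  ext x
  simp only [Set.mem_smul, mem_image, mem_preimage, Set.mem_neg]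
  constructor
  · rintro ⟨r, hr, _, ⟨d, hd, rfl⟩, rfl⟩
    exact ⟨r, hr, _, ⟨-d, hd, rfl⟩, by simp⟩
  · rintro ⟨r, hr, _, ⟨d, hd, rfl⟩, h⟩
    refine ⟨r, hr, _, ⟨-d, by simpa using hd, rfl⟩, ?_⟩
    rw [← neg_neg x, ← h]; simp

/-- The cone over the band stays inside the slab of the ball, so the volume comparison applies. The
two caps outside the band share at least 6/7 of the mass equally. -/
theorem uniformSphere_slab_le {m : ℕ} (v : Vec (m + 1)) (hv : ‖v‖ = 1) :
    uniformSphere (m + 1) {d | |inner ℝ v (d : Vec (m + 1))| < 1 / (7 * √((m : ℝ) + 1))} ≤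
      ENNReal.ofReal (1 / 7) := by
  have hs : MeasurableSet {d : USphere (m + 1) |
      |inner ℝ v (d : Vec (m + 1))| < 1 / (7 * √((m : ℝ) + 1))} :=
    measurableSet_lt (by fun_prop) (by fun_prop)
  rw [uniformSphere_apply hs, mul_comm, ← div_eq_mul_inv]
  refine ENNReal.div_le_of_le_mul ?_
  refine le_trans (measure_mono ?_) ((volume_ball_inter_slab_le v hv _).trans
    (volume_unitBall_vec_le m))
  rintro _ ⟨r, hr, _, ⟨d, hd, rfl⟩, rfl⟩
  have hd1 : ‖(d : Vec (m + 1))‖ = 1 := by simp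
  have hd2 : |inner ℝ v (d : Vec (m + 1))| < 1 / (7 * √((m : ℝ) + 1)) := hd
  refine ⟨?_, ?_⟩
  · simp only [norm_smul, hd1, mul_one, Real.norm_eq_abs, abs_of_pos hr.1]; exact hr.2
  · simp only [inner_smul_right, abs_mul, abs_of_pos hr.1]
    refine lt_of_le_of_lt ?_ hd2
    exact mul_le_of_le_one_left (abs_nonneg _) hr.2.le

/-- A uniform direction makes an angle of cosine at least `1 / (7 √n)` with a given vector with
probability at least `3 / 7`. -/
theorem three_sevenths_le_uniformSphere_cap {n : ℕ} (hn : 0 < n) (g : Vec n) :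
    3 / 7 ≤ (uniformSphere n).real
      {d | inner ℝ g (d : Vec n) ≤ -(‖g‖ / (7 * √(n : ℝ)))} := by
  obtain ⟨m, rfl⟩ : ∃ m, n = m + 1 := ⟨n - 1, by omega⟩
  rcases eq_or_ne g 0 with rfl | hg
  · simp; norm_num
  have hg' : 0 < ‖g‖ := norm_pos_iff.2 hg
  set v : Vec (m + 1) := ‖g‖⁻¹ • g
  have hv : ‖v‖ = 1 := by simp [v, norm_smul, hg]
  set a := 1 / (7 * √((m : ℝ) + 1))
  set s : Set (USphere (m + 1)) := {d | inner ℝ v (d : Vec (m + 1)) ≤ -a}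
  set t : Set (USphere (m + 1)) := {d | |inner ℝ v (d : Vec (m + 1))| < a}
  have hs : MeasurableSet s := measurableSet_le (by fun_prop) (by fun_prop)
  have e : {d : USphere (m + 1) | inner ℝ g (d : Vec (m + 1)) ≤
      -(‖g‖ / (7 * √((m + 1 : ℕ) : ℝ)))} = s := by
    ext d
    simp only [s, v, a, mem_ofPred_eq, inner_smul_left, Nat.cast_add, Nat.cast_one]
    have : (starRingEnd ℝ) ‖g‖⁻¹ * inner ℝ g (d : Vec (m + 1)) =
      inner ℝ g (d : Vec (m + 1)) / ‖g‖ := by simp [div_eq_inv_mul]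
    rw [this, div_le_iff₀ hg']
    ring_nf
  rw [e]
  have ht : (uniformSphere (m + 1)).real t ≤ 1 / 7 :=
    ENNReal.toReal_le_of_le_ofReal (by norm_num) (uniformSphere_slab_le v hv)
  have hneg : (uniformSphere (m + 1)).real (Neg.neg ⁻¹' s) = (uniformSphere (m + 1)).real s := by
    rw [Measure.real, uniformSphere_neg hs, Measure.real]
  have hcov : (univ : Set (USphere (m + 1))) ⊆ s ∪ Neg.neg ⁻¹' s ∪ t := by
    intro d _
    by_contra h
    simp only [mem_union, not_or] at h
    obtain ⟨⟨h1, h2⟩, h3⟩ := h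
    simp only [s, t, mem_preimage, mem_ofPred_eq, not_le, not_lt] at h1 h2 h3
    have h2' : -a < -inner ℝ v (d : Vec (m + 1)) := by simpa using h2
    exact absurd (abs_lt.2 ⟨h1, by linarith⟩) (not_lt.2 h3)
  have h1 := measureReal_mono (μ := uniformSphere (m + 1)) hcov
  have h2 := measureReal_union_le (μ := uniformSphere (m + 1)) (s ∪ Neg.neg ⁻¹' s) t
  have h3 := measureReal_union_le (μ := uniformSphere (m + 1)) s (Neg.neg ⁻¹' s)
  rw [probReal_univ] at h1
  linarith

end UniformDirection

/-! ### Consequences of a Lipschitz gradient. -/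

theorem le_add_inner_add_of_lipschitzWith_gradient {n : ℕ} {f : Vec n → ℝ} {L : ℝ≥0}
    (hf : ContDiff ℝ 1 f) (hL : LipschitzWith L (∇ f)) (x h : Vec n) :
    f (x + h) ≤ f x + inner ℝ (∇ f x) h + L / 2 * ‖h‖ ^ 2 := by
  have hd : ∀ t : ℝ, HasDerivAt (fun t : ℝ => f (x + t • h)) (inner ℝ (∇ f (x + t • h)) h) t := by
    intro t
    have h1 : HasGradientAt f (∇ f (x + t • h)) (x + t • h) :=
      (hf.differentiable one_ne_zero _).hasGradientAt
    have h2 : HasDerivAt (fun t : ℝ => x + t • h) h t := by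
      simpa using ((hasDerivAt_id t).smul_const h).const_add x
    exact h1.hasFDerivAt.comp_hasDerivAt t h2
  have hB : ∀ t : ℝ, HasDerivAt
      (fun t : ℝ => f x + t * inner ℝ (∇ f x) h + L / 2 * ‖h‖ ^ 2 * t ^ 2)
      (inner ℝ (∇ f x) h + L * ‖h‖ ^ 2 * t) t := by
    intro t
    refine ((((hasDerivAt_id t).mul_const (inner ℝ (∇ f x) h)).const_add (f x)).add
      ((hasDerivAt_pow 2 t).const_mul (L / 2 * ‖h‖ ^ 2))).congr_deriv ?_
    simp
    ring
  have := image_le_of_deriv_right_le_deriv_boundary (a := 0) (b := 1)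
    (fun t _ => (hd t).continuousAt.continuousWithinAt)
    (fun t _ => (hd t).hasDerivWithinAt) (by simp)
    (fun t _ => (hB t).continuousAt.continuousWithinAt)
    (fun t _ => (hB t).hasDerivWithinAt) (fun t ht => ?_) (right_mem_Icc.2 zero_le_one)
  · simpa using this
  · have h1 : inner ℝ (∇ f (x + t • h) - ∇ f x) h ≤ L * ‖h‖ ^ 2 * t := by
      refine (real_inner_le_norm _ _).trans ?_
      have h2 := hL.norm_sub_le (x + t • h) x
      rw [add_sub_cancel_left, norm_smul, Real.norm_eq_abs, abs_of_nonneg ht.1] at h2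
      calc _ ≤ L * (t * ‖h‖) * ‖h‖ := by gcongr
        _ = _ := by ring
    rw [inner_sub_left] at h1
    linarith

/-- A gradient step of length factor t = 1/L cannot go below m. For L = 0 arbitrarily long steps are
allowed, which forces the gradient to vanish. -/
theorem norm_gradient_sq_le {n : ℕ} {f : Vec n → ℝ} {L : ℝ≥0}
    (hf : ContDiff ℝ 1 f) (hL : LipschitzWith L (∇ f)) {m : ℝ} (hm : ∀ x, m ≤ f x) (x : Vec n) :
    ‖∇ f x‖ ^ 2 ≤ 2 * L * (f x - m) := by
  have key : ∀ t : ℝ, t * ‖∇ f x‖ ^ 2 - L / 2 * t ^ 2 * ‖∇ f x‖ ^ 2 ≤ f x - m := by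
    intro t
    have h := le_add_inner_add_of_lipschitzWith_gradient hf hL x (-(t • ∇ f x))
    have h2 := hm (x + -(t • ∇ f x))
    rw [inner_neg_right, inner_smul_right, real_inner_self_eq_norm_sq, norm_neg, norm_smul,
      mul_pow, Real.norm_eq_abs, sq_abs] at h
    linarith
  rcases eq_or_lt_of_le L.coe_nonneg with h0 | h0
  · rw [← h0] at key ⊢
    by_contra! hc
    have hpos : 0 < ‖∇ f x‖ ^ 2 := by linarith
    have := key ((f x - m + 1) / ‖∇ f x‖ ^ 2)
    rw [div_mul_cancel₀ _ hpos.ne'] at this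
    linarith
  · have := key (1 / L)
    have e : 1 / (L : ℝ) * ‖∇ f x‖ ^ 2 - L / 2 * (1 / L) ^ 2 * ‖∇ f x‖ ^ 2
      = ‖∇ f x‖ ^ 2 / (2 * L) := by field_simp; ring
    rw [e, div_le_iff₀ (by positivity)] at this
    linarith

/-- Along a direction with a large component on `-∇f`, a short step decreases `f` sufficiently. -/
theorem sufficient_decrease_of_inner_le {n : ℕ} (hn : 0 < n) {f : Vec n → ℝ} {L : ℝ≥0}
    (hf : ContDiff ℝ 1 f) (hL : LipschitzWith L (∇ f)) (P : SearchParams) {ε δ : ℝ}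
    {x : Vec n} (hx : ε ≤ ‖∇ f x‖) (hδ : 0 ≤ δ) (hδε : δ ≤ P.threshold L n ε) {d : USphere n}
    (hd : inner ℝ (∇ f x) (d : Vec n) ≤ -(‖∇ f x‖ / (7 * √(n : ℝ)))) :
    P.c * δ ^ 2 - (f x - f (x + δ • (d : Vec n))) ≤ 0 := by
  have hc := P.c_pos
  have hn' : (0 : ℝ) < √(n : ℝ) := Real.sqrt_pos.2 (by exact_mod_cast hn)
  have h := le_add_inner_add_of_lipschitzWith_gradient hf hL x (δ • (d : Vec n))
  have hd1 : ‖(d : Vec n)‖ = 1 := by simp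
  rw [inner_smul_right, norm_smul, hd1, mul_one, Real.norm_eq_abs, sq_abs] at h
  have h1 : inner ℝ (∇ f x) (d : Vec n) ≤ -(ε / (7 * √(n : ℝ))) := by
    refine hd.trans (neg_le_neg ?_); gcongr
  have h2 := mul_le_mul_of_nonneg_left h1 hδ
  -- The threshold is the step size at which the first-order gain ε/(7√n) exactly pays for curvature
  -- L/2 plus the demanded decrease c.
  have e : P.threshold L n ε * ((L : ℝ) / 2 + P.c) = ε / (7 * √(n : ℝ)) := by
    rw [SearchParams.threshold]
    have : (7 * (L : ℝ) + 14 * P.c) ≠ 0 := by positivity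
    field_simp
    ring
  have h3 : δ * ((L : ℝ) / 2 + P.c) ≤ ε / (7 * √(n : ℝ)) := by
    rw [← e]; gcongr
  have h4 := mul_le_mul_of_nonneg_left h3 hδ
  nlinarith

/-! ### Fresh randomness and acceptance probabilities. -/

/-- Fubini for the product law of (Z, Y): Z is frozen and Y integrated out. It plays the role of
conditioning on Z, for the direction as well as for the noise. -/
theorem setIntegral_of_indepFun {Ω α β : Type*} [MeasurableSpace Ω] [MeasurableSpace α]
    [MeasurableSpace β] {μ : Measure Ω} [IsProbabilityMeasure μ] {Z : Ω → α} {Y : Ω → β}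
    (hZ : Measurable Z) (hY : Measurable Y) (hind : IndepFun Z Y μ) {B : Set (α × β)}
    (hB : MeasurableSet B) {h : α → ℝ} (hh : Measurable h) (hi : Integrable (fun ω => h (Z ω)) μ) :
    ∫ ω in {ω | (Z ω, Y ω) ∈ B}, h (Z ω) ∂μ =
      ∫ ω, (μ.map Y).real (Prod.mk (Z ω) ⁻¹' B) * h (Z ω) ∂μ := by
  have : IsProbabilityMeasure (μ.map Y) := Measure.isProbabilityMeasure_map hY.aemeasurable
  have : IsProbabilityMeasure (μ.map Z) := Measure.isProbabilityMeasure_map hZ.aemeasurable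
  have hmap := (indepFun_iff_map_prod_eq_prod_map_map hZ.aemeasurable hY.aemeasurable).1 hind
  set G : α × β → ℝ := B.indicator (fun p => h p.1)
  have hG : Measurable G := (hh.comp measurable_fst).indicator hB
  have hset : MeasurableSet {ω | (Z ω, Y ω) ∈ B} := (hZ.prodMk hY) hB
  have hcomp : {ω | (Z ω, Y ω) ∈ B}.indicator (fun ω => h (Z ω)) = fun ω => G (Z ω, Y ω) := by
    ext ω; simp only [G, Set.indicator]; rfl
  have hGi : Integrable G ((μ.map Z).prod (μ.map Y)) := by
    rw [← hmap, integrable_map_measure hG.aestronglyMeasurable (hZ.prodMk hY).aemeasurable]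
    have := hi.indicator hset
    rw [hcomp] at this
    exact this
  rw [← integral_indicator hset, hcomp,
    ← integral_map (φ := fun ω => (Z ω, Y ω)) (hZ.prodMk hY).aemeasurable
      hG.aestronglyMeasurable, hmap, integral_prod _ hGi,
    integral_map hZ.aemeasurable hGi.aestronglyMeasurable.integral_prod_right']
  refine integral_congr_ae (.of_forall fun ω => ?_)
  have : (fun y => G (Z ω, y)) = (Prod.mk (Z ω) ⁻¹' B).indicator (fun _ => h (Z ω)) := by
    ext y; simp only [G, Set.indicator]; rfl
  simp only [this]
  rw [integral_indicator (measurable_prodMk_left hB)]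
  simp

section Algorithm

variable {n : ℕ} {Ξ Ω : Type*} [MeasurableSpace Ξ] [MeasurableSpace Ω] {P : SearchParams}
  {f : Vec n → ℝ} {F : Vec n → Ξ → ℝ} {ρ : Measure Ξ} {test : TestRule n} {x₀ : Vec n}
  {D : ℕ → Ω → USphere n} {ξ : ℕ → Ω → ℕ → Ξ × Ξ} {μ : Measure Ω}

theorem measurable_decreaseStat (hF : Measurable (fun p : Vec n × Ξ => F p.1 p.2)) (c : ℝ) :
    Measurable (fun q : ((Vec n × ℝ) × USphere n) × (Ξ × Ξ) =>
      decreaseStat F c q.1.1.1 q.1.1.2 q.1.2 q.2) := by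
  unfold decreaseStat
  have h1 : Measurable (fun q : ((Vec n × ℝ) × USphere n) × (Ξ × Ξ) => F q.1.1.1 q.2.1) :=
    hF.comp (by fun_prop : Measurable (fun q : ((Vec n × ℝ) × USphere n) × (Ξ × Ξ) =>
      (q.1.1.1, q.2.1)))
  have h2 : Measurable (fun q : ((Vec n × ℝ) × USphere n) × (Ξ × Ξ) =>
      F (q.1.1.1 + q.1.1.2 • (q.1.2 : Vec n)) q.2.2) :=
    hF.comp (by fun_prop : Measurable (fun q : ((Vec n × ℝ) × USphere n) × (Ξ × Ξ) =>
      (q.1.1.1 + q.1.1.2 • (q.1.2 : Vec n), q.2.2)))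
  fun_prop

theorem IsUnbiasedOracle.integral_decreaseLaw (hF : IsUnbiasedOracle f F ρ) (c : ℝ) (x : Vec n)
    (δ : ℝ) (d : USphere n) :
    ∫ y, y ∂(decreaseLaw F ρ c x δ d) = c * δ ^ 2 - (f x - f (x + δ • (d : Vec n))) := by
  have := hF.isProbabilityMeasure
  have hm : Measurable (decreaseStat F c x δ d) :=
    (measurable_decreaseStat hF.measurable c).comp (measurable_prodMk_left (x := ((x, δ), d)))
  rw [decreaseLaw, integral_map hm.aemeasurable (f := fun y => y) measurable_id.aestronglyMeasurable]
  have h1 : Integrable (fun p : Ξ × Ξ => F x p.1) (ρ.prod ρ) := (hF.integrable x).comp_fst ρ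
  have h2 : Integrable (fun p : Ξ × Ξ => F (x + δ • (d : Vec n)) p.2) (ρ.prod ρ) :=
    (hF.integrable _).comp_snd ρ
  have h3 : Integrable (fun p : Ξ × Ξ => F x p.1 - F (x + δ • (d : Vec n)) p.2) (ρ.prod ρ) :=
    h1.sub h2
  simp only [decreaseStat]
  rw [integral_sub (integrable_const _) h3, integral_sub h1 h2,
    integral_fun_fst (fun y => F x y), integral_fun_snd (fun y => F (x + δ • (d : Vec n)) y)]
  simp [hF.integral_eq]

/-- The set of inputs with which iteration `k` accepts the candidate point. -/
def acceptSet (P : SearchParams) (F : Vec n → Ξ → ℝ) (test : TestRule n) (k : ℕ) :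
    Set (((Vec n × ℝ) × USphere n) × (ℕ → Ξ × Ξ)) :=
  {q | stepAccepted P F test k q.1.1.1 q.1.1.2 q.1.2 q.2}

theorem measurableSet_acceptSet (hF : IsUnbiasedOracle f F ρ) (ht : test.IsAdmissible P F ρ)
    (k : ℕ) : MeasurableSet (acceptSet P F test k) := by
  have h : Measurable (fun q : ((Vec n × ℝ) × USphere n) × (ℕ → Ξ × Ξ) =>
      ((q.1.1.1, q.1.1.2, q.1.2),
        (fun l => decreaseStat F P.c q.1.1.1 q.1.1.2 q.1.2 (q.2 l) : ℕ → ℝ))) := by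
    refine Measurable.prodMk (by fun_prop) (measurable_pi_lambda _ fun l => ?_)
    exact (measurable_decreaseStat hF.measurable P.c).comp
      (by fun_prop : Measurable (fun q : ((Vec n × ℝ) × USphere n) × (ℕ → Ξ × Ξ) => (q.1, q.2 l)))
  exact h (ht.measurable k)

/-- The probability that iteration `k` accepts the candidate point, given the current point, step
size and direction. -/
noncomputable def acceptProb (P : SearchParams) (F : Vec n → Ξ → ℝ) (ρ : Measure Ξ) (test : TestRule n) (k : ℕ)
    (w : (Vec n × ℝ) × USphere n) : ℝ :=
  (iidLaw (ρ.prod ρ)).real (Prod.mk w ⁻¹' acceptSet P F test k)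

/-- Applying the statistic to each noise pair sends the i.i.d. law of the pairs to the i.i.d. law of
the statistic, the one for which accuracy is assumed. -/
theorem acceptProb_eq (hF : IsUnbiasedOracle f F ρ) (ht : test.IsAdmissible P F ρ) (k : ℕ)
    (x : Vec n) (δ : ℝ) (d : USphere n) : acceptProb P F ρ test k ((x, δ), d) =
      (iidLaw (decreaseLaw F ρ P.c x δ d)).real (test k x δ d).acceptsH0 := by
  have := hF.isProbabilityMeasure
  have hm : Measurable (decreaseStat F P.c x δ d) :=
    (measurable_decreaseStat hF.measurable P.c).comp (measurable_prodMk_left (x := ((x, δ), d)))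
  have hA : MeasurableSet (test k x δ d).acceptsH0 :=
    (measurable_prodMk_left (x := (x, δ, d))) (ht.measurable k)
  have e : iidLaw (decreaseLaw F ρ P.c x δ d) = (iidLaw (ρ.prod ρ)).map
      (fun y l => decreaseStat F P.c x δ d (y l)) := by
    rw [iidLaw, iidLaw, Measure.infinitePi_map_pi _ (fun _ => hm)]; rfl
  rw [e, acceptProb, Measure.real, Measure.real, Measure.map_apply (by fun_prop) hA]
  rfl

end Algorithm

namespace SearchParams

variable (P : SearchParams)

theorem sq_sub_sq_pos : 0 < P.γ ^ 2 - P.θ ^ 2 := by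
  have := P.θ_pos; have := P.θ_lt_one; have := P.one_lt_γ
  nlinarith

theorem one_sub_sq_pos : 0 < 1 - P.θ ^ 2 := by
  have := P.θ_pos; have := P.θ_lt_one
  nlinarith

theorem accuracy_nonneg (δ : ℝ) : 0 ≤ P.accuracy δ := by
  have := P.sq_sub_sq_pos; have := P.one_sub_sq_pos; have := P.c_pos
  unfold accuracy
  positivity

end SearchParams

/-! ### Measurability of the state with respect to the history. -/

section Sigma

variable {n : ℕ} {Ξ Ω : Type*} {P : SearchParams}
  {F : Vec n → Ξ → ℝ} {test : TestRule n} {x₀ : Vec n}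
  {D : ℕ → Ω → USphere n} {ξ : ℕ → Ω → ℕ → Ξ × Ξ}

/-- The σ-algebra on Ω is arbitrary, so that this serves both for the ambient one and for
`pastSigma`. -/
theorem measurable_searchState_of_forall_lt [MeasurableSpace Ω] (k : ℕ) (hD : ∀ j < k, Measurable (D j))
    (hA : ∀ j < k, MeasurableSet {ω | searchAccepts P F test x₀ D ξ j ω}) :
    Measurable (searchState P F test x₀ D ξ k) := by
  induction k with
  | zero => exact measurable_const
  | succ k ih =>
    have h := ih (fun j hj => hD j (by omega)) (fun j hj => hA j (by omega))
    have h1 := hD k (by omega)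
    exact Measurable.ite (hA k (by omega)) (by fun_prop) (by fun_prop)

theorem pastSigma_mono : Monotone (pastSigma P F test x₀ D ξ) := fun _ _ h =>
  iSup_mono fun _ => iSup_mono' fun hj => ⟨hj.trans_le h, le_rfl⟩

theorem measurable_searchState_pastSigma (k : ℕ) :
    Measurable[pastSigma P F test x₀ D ξ k] (searchState P F test x₀ D ξ k) := by
  refine @measurable_searchState_of_forall_lt n Ξ Ω P F test x₀ D ξ (pastSigma P F test x₀ D ξ k) k
    (fun j hj => ?_) (fun j hj => ?_)
  · exact Measurable.of_comap_le (le_sup_left.trans (le_iSup₂_of_le j hj le_rfl))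
  · refine (le_sup_right.trans (le_iSup₂_of_le (f := fun j (_ : j < k) =>
      MeasurableSpace.comap (D j) inferInstance ⊔
        MeasurableSpace.comap (searchAccepts P F test x₀ D ξ j) ⊤) j hj le_rfl)) _ ?_
    refine ⟨{True}, trivial, ?_⟩
    ext ω
    simp

theorem measurable_dir_midSigma (k : ℕ) : Measurable[midSigma P F test x₀ D ξ k] (D k) :=
  Measurable.of_comap_le le_sup_right

end Sigma

/-! ### Acceptance bounds for one iteration. -/

section Algorithm

variable {n : ℕ} {Ξ Ω : Type*} [MeasurableSpace Ξ] [MeasurableSpace Ω] {P : SearchParams}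
  {f : Vec n → ℝ} {F : Vec n → Ξ → ℝ} {ρ : Measure Ξ} {test : TestRule n} {x₀ : Vec n}
  {D : ℕ → Ω → USphere n} {ξ : ℕ → Ω → ℕ → Ξ × Ξ} {μ : Measure Ω}

theorem acceptProb_nonneg (k : ℕ) (w : (Vec n × ℝ) × USphere n) :
    0 ≤ acceptProb P F ρ test k w := measureReal_nonneg

theorem acceptProb_le_one (hF : IsUnbiasedOracle f F ρ) (k : ℕ) (w : (Vec n × ℝ) × USphere n) :
    acceptProb P F ρ test k w ≤ 1 := by
  have := hF.isProbabilityMeasure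
  have : IsProbabilityMeasure (iidLaw (ρ.prod ρ)) := by unfold iidLaw; infer_instance
  exact measureReal_le_one

theorem measurable_acceptProb (hF : IsUnbiasedOracle f F ρ) (ht : test.IsAdmissible P F ρ)
    (k : ℕ) : Measurable (acceptProb P F ρ test k) := by
  have := hF.isProbabilityMeasure
  have : IsProbabilityMeasure (iidLaw (ρ.prod ρ)) := by unfold iidLaw; infer_instance
  exact (measurable_measure_prodMk_left (measurableSet_acceptSet hF ht k)).ennreal_toReal

/-- Since the test ends almost surely, the two decisions exhaust the probability, and the wrong one
has at most 1/2. -/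
theorem half_le_acceptProb (hF : IsUnbiasedOracle f F ρ) (ht : test.IsAdmissible P F ρ) (k : ℕ)
    {x : Vec n} {δ : ℝ} {d : USphere n} (hδ : 0 < δ)
    (h : P.c * δ ^ 2 - (f x - f (x + δ • (d : Vec n))) ≤ 0) :
    1 / 2 ≤ acceptProb P F ρ test k ((x, δ), d) := by
  have := hF.isProbabilityMeasure
  have hm : Measurable (decreaseStat F P.c x δ d) :=
    (measurable_decreaseStat hF.measurable P.c).comp (measurable_prodMk_left (x := ((x, δ), d)))
  have : IsProbabilityMeasure (decreaseLaw F ρ P.c x δ d) :=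
    Measure.isProbabilityMeasure_map hm.aemeasurable
  have : IsProbabilityMeasure (iidLaw (decreaseLaw F ρ P.c x δ d)) := by
    unfold iidLaw; infer_instance
  rw [acceptProb_eq hF ht]
  have h1 := (ht.isAccurate k x δ d hδ).1 (by rwa [hF.integral_decreaseLaw])
  have h2 : (iidLaw (decreaseLaw F ρ P.c x δ d)).real
      ((test k x δ d).acceptsH0 ∪ (test k x δ d).acceptsH1) = 1 := by
    rw [measureReal_congr (Filter.eventuallyEq_univ.2 ?_), probReal_univ]
    filter_upwards [ht.endsProperly k x δ d hδ] with y hy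
    by_cases hd : y ∈ (test k x δ d).decideH0
    · exact Or.inl ⟨hy, hd⟩
    · exact Or.inr ⟨hy, hd⟩
  have h3 := measureReal_union_le (μ := iidLaw (decreaseLaw F ρ P.c x δ d))
    (test k x δ d).acceptsH0 (test k x δ d).acceptsH1
  linarith

/-- Accuracy in product form holds for every sign of the mean: when the mean is nonpositive the left
side is too. -/
theorem acceptProb_mul_le_accuracy (hF : IsUnbiasedOracle f F ρ) (ht : test.IsAdmissible P F ρ)
    (k : ℕ) {x : Vec n} {δ : ℝ} {d : USphere n} (hδ : 0 < δ) :
    acceptProb P F ρ test k ((x, δ), d) * (P.c * δ ^ 2 - (f x - f (x + δ • (d : Vec n)))) ≤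
      P.accuracy δ := by
  rcases le_or_gt (P.c * δ ^ 2 - (f x - f (x + δ • (d : Vec n)))) 0 with h | h
  · exact (mul_nonpos_of_nonneg_of_nonpos (acceptProb_nonneg _ _) h).trans (P.accuracy_nonneg δ)
  · have h1 := (ht.isAccurate k x δ d hδ).2 (by rwa [hF.integral_decreaseLaw])
    rw [hF.integral_decreaseLaw, le_div_iff₀ h, ← acceptProb_eq hF ht] at h1
    exact h1

theorem IsSearchRun.measurable_searchState (hF : IsUnbiasedOracle f F ρ)
    (ht : test.IsAdmissible P F ρ) (hR : IsSearchRun P F ρ test x₀ D ξ μ) (k : ℕ) :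
    Measurable (searchState P F test x₀ D ξ k) ∧
      MeasurableSet {ω | searchAccepts P F test x₀ D ξ k ω} := by
  induction k using Nat.strong_induction_on with
  | _ k ih =>
    have h := measurable_searchState_of_forall_lt k (fun j _ => hR.measurable_dir j)
      (fun j hj => (ih j hj).2)
    exact ⟨h, ((h.prodMk (hR.measurable_dir k)).prodMk (hR.measurable_noise k))
      (measurableSet_acceptSet hF ht k)⟩

theorem IsSearchRun.midSigma_le (hF : IsUnbiasedOracle f F ρ) (ht : test.IsAdmissible P F ρ)
    (hR : IsSearchRun P F ρ test x₀ D ξ μ) (k : ℕ) :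
    midSigma P F test x₀ D ξ k ≤ ‹MeasurableSpace Ω› := by
  refine sup_le (iSup₂_le fun j _ => sup_le (hR.measurable_dir j).comap_le ?_)
    (hR.measurable_dir k).comap_le
  exact (measurableSet_setOfPred.1 (hR.measurable_searchState hF ht j).2).comap_le

/-- Given the past and the direction, the candidate point is accepted with probability
`acceptProb`. -/
theorem IsSearchRun.setIntegral_searchAccepts [IsProbabilityMeasure μ]
    (hF : IsUnbiasedOracle f F ρ) (ht : test.IsAdmissible P F ρ)
    (hR : IsSearchRun P F ρ test x₀ D ξ μ) (k : ℕ) {h : Ω → ℝ}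
    (hm : Measurable[midSigma P F test x₀ D ξ k] h) (hi : Integrable h μ) :
    ∫ ω in {ω | searchAccepts P F test x₀ D ξ k ω}, h ω ∂μ =
      ∫ ω, acceptProb P F ρ test k (searchState P F test x₀ D ξ k ω, D k ω) * h ω ∂μ := by
  have hmid : Measurable[midSigma P F test x₀ D ξ k]
      (fun ω => ((searchState P F test x₀ D ξ k ω, D k ω), h ω)) :=
    (((measurable_searchState_pastSigma k).mono le_sup_left le_rfl).prodMk
      (measurable_dir_midSigma k)).prodMk hm
  -- The weight h is packed with state and direction into one variable independent of the noise.
  have hind : IndepFun (fun ω => ((searchState P F test x₀ D ξ k ω, D k ω), h ω)) (ξ k) μ :=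
    indep_of_indep_of_le_left (hR.indep_noise k) hmid.comap_le
  have key := setIntegral_of_indepFun
    (hmid.mono (hR.midSigma_le hF ht k) le_rfl) (hR.measurable_noise k) hind
    (B := {q | (q.1.1, q.2) ∈ acceptSet P F test k})
    ((by fun_prop : Measurable
      (fun q : (((Vec n × ℝ) × USphere n) × ℝ) × (ℕ → Ξ × Ξ) => (q.1.1, q.2)))
      (measurableSet_acceptSet hF ht k)) (h := fun p => p.2) measurable_snd hi
  rw [hR.law_noise k] at key
  exact key

/-- 3/14 = 3/7 · 1/2: the direction falls in the cap S with probability at least 3/7 given the past,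
and the test then accepts with probability at least 1/2. -/
theorem IsSearchRun.three_fourteenths_mul_le [IsProbabilityMeasure μ] (hn : 0 < n)
    (hf : ContDiff ℝ 1 f) {L : ℝ≥0} (hL : LipschitzWith L (∇ f))
    (hF : IsUnbiasedOracle f F ρ) (ht : test.IsAdmissible P F ρ)
    (hR : IsSearchRun P F ρ test x₀ D ξ μ) (k : ℕ) {ε : ℝ} {G : Set Ω}
    (hG : MeasurableSet[pastSigma P F test x₀ D ξ k] G)
    (hGε : ∀ ω ∈ G, ε ≤ ‖∇ f (searchState P F test x₀ D ξ k ω).1‖ ∧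
      0 < (searchState P F test x₀ D ξ k ω).2 ∧
      (searchState P F test x₀ D ξ k ω).2 ≤ P.threshold L n ε) :
    3 / 14 * μ.real G ≤ μ.real (G ∩ {ω | searchAccepts P F test x₀ D ξ k ω}) := by
  have hmidle := hR.midSigma_le hF ht k
  have hG' : MeasurableSet G := hmidle _ (le_sup_left (a := pastSigma P F test x₀ D ξ k) _ hG)
  have hg : Measurable (∇ f) := hL.continuous.measurable
  set h : Ω → ℝ := G.indicator 1
  have hi : Integrable h μ := (integrable_const (1 : ℝ)).indicator hG'
  have hm : Measurable[pastSigma P F test x₀ D ξ k] h :=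
    (@measurable_one ℝ Ω _ (pastSigma P F test x₀ D ξ k) _).indicator hG
  have hint : ∫ ω, h ω ∂μ = μ.real G := by simp [h, integral_indicator_one hG']
  have hset : ∀ {A : Set Ω}, ∫ ω in A, h ω ∂μ = μ.real (G ∩ A) := by
    intro A
    rw [integral_indicator_one hG', measureReal_restrict_apply hG']
  have hpm : Measurable[pastSigma P F test x₀ D ξ k]
      (fun ω => ((searchState P F test x₀ D ξ k ω).1, h ω)) :=
    (measurable_fst.comp (measurable_searchState_pastSigma k)).prodMk hm
  have hind : IndepFun (fun ω => ((searchState P F test x₀ D ξ k ω).1, h ω)) (D k) μ :=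
    indep_of_indep_of_le_left (hR.indep_dir k) hpm.comap_le
  set B : Set ((Vec n × ℝ) × USphere n) :=
    {q | inner ℝ (∇ f q.1.1) (q.2 : Vec n) ≤ -(‖∇ f q.1.1‖ / (7 * √(n : ℝ)))} with hBdef
  have hB : MeasurableSet B := measurableSet_le (by fun_prop) (by fun_prop)
  set S : Set Ω := {ω | (((searchState P F test x₀ D ξ k ω).1, h ω), D k ω) ∈ B}
  have key := setIntegral_of_indepFun (hpm.mono (le_sup_left.trans hmidle) le_rfl)
    (hR.measurable_dir k) hind hB (h := fun p => p.2) measurable_snd hi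
  rw [hR.law_dir k] at key
  have hS : MeasurableSet S :=
    ((hpm.mono (le_sup_left.trans hmidle) le_rfl).prodMk (hR.measurable_dir k)) hB
  have : IsProbabilityMeasure (uniformSphere n) := by
    rw [← hR.law_dir k]; exact Measure.isProbabilityMeasure_map (hR.measurable_dir k).aemeasurable
  have hnn : ∀ ω, 0 ≤ h ω := fun ω => Set.indicator_nonneg (fun _ _ => zero_le_one) ω
  have h1 : 3 / 7 * μ.real G ≤ μ.real (G ∩ S) := by
    rw [← hset, ← hint, ← integral_const_mul]
    refine le_trans ?_ key.ge
    refine integral_mono (hi.const_mul _) ?_ fun ω => ?_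
    · refine Integrable.mono' hi ?_ (.of_forall fun ω => ?_)
      · refine (Measurable.mul ?_ (hm.mono (le_sup_left.trans hmidle) le_rfl)).aestronglyMeasurable
        exact (measurable_measure_prodMk_left (ν := uniformSphere n) hB).ennreal_toReal.comp
          (hpm.mono (le_sup_left.trans hmidle) le_rfl)
      · rw [norm_mul, Real.norm_eq_abs, Real.norm_eq_abs, abs_of_nonneg measureReal_nonneg,
          abs_of_nonneg (hnn ω)]
        exact mul_le_of_le_one_left (hnn ω) measureReal_le_one
    · exact mul_le_mul_of_nonneg_right
        (three_sevenths_le_uniformSphere_cap hn (∇ f (searchState P F test x₀ D ξ k ω).1)) (hnn ω)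
  have hstep := hR.setIntegral_searchAccepts hF ht k (hm.mono le_sup_left le_rfl) hi
  rw [hset] at hstep
  have hW : Measurable (fun ω => (searchState P F test x₀ D ξ k ω, D k ω)) :=
    (hR.measurable_searchState hF ht k).1.prodMk (hR.measurable_dir k)
  have h2 : 1 / 2 * μ.real (G ∩ S) ≤
      μ.real (G ∩ {ω | searchAccepts P F test x₀ D ξ k ω}) := by
    rw [hstep, ← integral_indicator_one (hG'.inter hS), ← integral_const_mul]
    refine integral_mono (((integrable_const (1 : ℝ)).indicator (hG'.inter hS)).const_mul _) ?_
      fun ω => ?_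
    · refine Integrable.mono' hi ?_ (.of_forall fun ω => ?_)
      · exact (((measurable_acceptProb hF ht k).comp hW).mul
          (hm.mono (le_sup_left.trans hmidle) le_rfl)).aestronglyMeasurable
      · rw [norm_mul, Real.norm_eq_abs, Real.norm_eq_abs, abs_of_nonneg (acceptProb_nonneg _ _),
          abs_of_nonneg (hnn ω)]
        exact mul_le_of_le_one_left (hnn ω) (acceptProb_le_one hF _ _)
    · by_cases hω : ω ∈ G ∩ S
      · obtain ⟨e1, e2, e3⟩ := hGε ω hω.1
        have := half_le_acceptProb hF ht k e2
          (sufficient_decrease_of_inner_le hn hf hL P e1 e2.le e3 hω.2)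
        simp only [h, indicator_of_mem hω, indicator_of_mem hω.1, Pi.one_apply, mul_one]
        exact this
      · simp only [indicator_of_notMem hω, mul_zero]
        exact mul_nonneg (acceptProb_nonneg _ _) (hnn ω)
  linarith

end Algorithm

/-! ### Pathwise behaviour of the state. -/

section Dynamics

variable {n : ℕ} {Ξ Ω : Type*} {P : SearchParams}
  {F : Vec n → Ξ → ℝ} {test : TestRule n} {x₀ : Vec n}
  {D : ℕ → Ω → USphere n} {ξ : ℕ → Ω → ℕ → Ξ × Ξ}

theorem searchState_succ_of_accepts {k : ℕ} {ω : Ω} (h : searchAccepts P F test x₀ D ξ k ω) :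
    searchState P F test x₀ D ξ (k + 1) ω =
      ((searchState P F test x₀ D ξ k ω).1 + (searchState P F test x₀ D ξ k ω).2 • (D k ω : Vec n),
        P.γ * (searchState P F test x₀ D ξ k ω).2) := if_pos h

theorem searchState_succ_of_not_accepts {k : ℕ} {ω : Ω}
    (h : ¬ searchAccepts P F test x₀ D ξ k ω) :
    searchState P F test x₀ D ξ (k + 1) ω =
      ((searchState P F test x₀ D ξ k ω).1, P.θ * (searchState P F test x₀ D ξ k ω).2) := if_neg h

theorem stepSize_pos (k : ℕ) (ω : Ω) : 0 < (searchState P F test x₀ D ξ k ω).2 := by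
  induction k with
  | zero => exact P.δ₀_pos
  | succ k ih =>
    by_cases h : searchAccepts P F test x₀ D ξ k ω
    · rw [searchState_succ_of_accepts h]
      exact mul_pos (zero_lt_one.trans P.one_lt_γ) ih
    · rw [searchState_succ_of_not_accepts h]
      exact mul_pos P.θ_pos ih

variable (P F test x₀ D ξ) in
-- Directions have unit length and a step size has only two successors, so for fixed k the state
-- stays in a deterministic compact set. Hence every continuous function of it is integrable.
theorem exists_isCompact_searchState_mem (k : ℕ) :
    ∃ C : Set (Vec n × ℝ), IsCompact C ∧ ∀ ω, searchState P F test x₀ D ξ k ω ∈ C := by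
  induction k with
  | zero => exact ⟨{(x₀, P.δ₀)}, isCompact_singleton, fun _ => rfl⟩
  | succ k ih =>
    obtain ⟨C, hC, h⟩ := ih
    refine ⟨(fun w : (Vec n × ℝ) × USphere n => (w.1.1 + w.1.2 • (w.2 : Vec n), P.γ * w.1.2)) ''
      (C ×ˢ univ) ∪ (fun w : Vec n × ℝ => (w.1, P.θ * w.2)) '' C,
      ((hC.prod isCompact_univ).image (by fun_prop)).union (hC.image (by fun_prop)), fun ω => ?_⟩
    by_cases hA : searchAccepts P F test x₀ D ξ k ω
    · exact Or.inl ⟨(searchState P F test x₀ D ξ k ω, D k ω), ⟨h ω, trivial⟩,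
        (searchState_succ_of_accepts hA).symm⟩
    · exact Or.inr ⟨searchState P F test x₀ D ξ k ω, h ω, (searchState_succ_of_not_accepts hA).symm⟩

end Dynamics

/-! ### The Lyapunov function and the sum of the squared step sizes. -/

section Lyapunov

variable {n : ℕ} {Ξ Ω : Type*} [MeasurableSpace Ξ] [MeasurableSpace Ω] {P : SearchParams}
  {f : Vec n → ℝ} {F : Vec n → Ξ → ℝ} {ρ : Measure Ξ} {test : TestRule n} {x₀ : Vec n}
  {D : ℕ → Ω → USphere n} {ξ : ℕ → Ω → ℕ → Ξ × Ξ} {μ : Measure Ω} [IsProbabilityMeasure μ]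

theorem IsSearchRun.integrable_comp_dir (hF : IsUnbiasedOracle f F ρ)
    (ht : test.IsAdmissible P F ρ) (hR : IsSearchRun P F ρ test x₀ D ξ μ) (k : ℕ)
    {φ : (Vec n × ℝ) × USphere n → ℝ} (hφ : Continuous φ) :
    Integrable (fun ω => φ (searchState P F test x₀ D ξ k ω, D k ω)) μ := by
  obtain ⟨C, hC, h⟩ := exists_isCompact_searchState_mem P F test x₀ D ξ k
  obtain ⟨b, hb⟩ := (hC.prod (isCompact_univ (X := USphere n))).exists_bound_of_continuousOn
    hφ.continuousOn
  refine Integrable.of_bound (hφ.measurable.comp ((hR.measurable_searchState hF ht k).1.prodMk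
    (hR.measurable_dir k))).aestronglyMeasurable b (.of_forall fun ω => hb _ ⟨h ω, trivial⟩)

theorem IsSearchRun.integrable_comp (hF : IsUnbiasedOracle f F ρ)
    (ht : test.IsAdmissible P F ρ) (hR : IsSearchRun P F ρ test x₀ D ξ μ) (k : ℕ)
    {φ : Vec n × ℝ → ℝ} (hφ : Continuous φ) :
    Integrable (fun ω => φ (searchState P F test x₀ D ξ k ω)) μ :=
  hR.integrable_comp_dir hF ht k (φ := fun w => φ w.1) (by fun_prop)

/-- The Lyapunov function `f(x) + c δ² / (γ² - θ²)`. -/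
noncomputable def lyapunov (P : SearchParams) (f : Vec n → ℝ) (s : Vec n × ℝ) : ℝ :=
  f s.1 + P.c / (P.γ ^ 2 - P.θ ^ 2) * s.2 ^ 2

theorem continuous_lyapunov (hf : Continuous f) : Continuous (lyapunov P f) := by
  unfold lyapunov
  fun_prop

theorem SearchParams.continuous_accuracy (P : SearchParams) : Continuous P.accuracy := by
  unfold SearchParams.accuracy
  fun_prop

theorem IsSearchRun.integral_lyapunov_succ_le (hf : Continuous f) (hF : IsUnbiasedOracle f F ρ)
    (ht : test.IsAdmissible P F ρ) (hR : IsSearchRun P F ρ test x₀ D ξ μ) (k : ℕ) :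
    ∫ ω, lyapunov P f (searchState P F test x₀ D ξ (k + 1) ω) ∂μ ≤
      ∫ ω, lyapunov P f (searchState P F test x₀ D ξ k ω) ∂μ -
        ∫ ω, P.accuracy (searchState P F test x₀ D ξ k ω).2 ∂μ := by
  have hq := P.sq_sub_sq_pos
  set φ : (Vec n × ℝ) × USphere n → ℝ := fun w =>
    P.c * w.1.2 ^ 2 - (f w.1.1 - f (w.1.1 + w.1.2 • (w.2 : Vec n))) with hφdef
  have hφ : Continuous φ := by fun_prop
  have hA := (hR.measurable_searchState hF ht k).2
  have hV := hR.integrable_comp hF ht k (continuous_lyapunov (P := P) hf)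
  have hacc := hR.integrable_comp hF ht k (φ := fun s => P.accuracy s.2)
    (P.continuous_accuracy.comp continuous_snd)
  have hφi := hR.integrable_comp_dir hF ht k hφ
  have hstep := hR.setIntegral_searchAccepts hF ht k (hφ.measurable.comp
    (((measurable_searchState_pastSigma k).mono le_sup_left le_rfl).prodMk
      (measurable_dir_midSigma k))) hφi
  simp only [Function.comp_apply] at hstep
  -- The weight c/(γ² - θ²) makes both cases exact: replacing the factor θ by γ on acceptance costs
  -- precisely c δ².
  have hpath : ∀ ω, lyapunov P f (searchState P F test x₀ D ξ (k + 1) ω) =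
      lyapunov P f (searchState P F test x₀ D ξ k ω) -
        2 * P.accuracy (searchState P F test x₀ D ξ k ω).2 +
        {ω | searchAccepts P F test x₀ D ξ k ω}.indicator
          (fun ω => φ (searchState P F test x₀ D ξ k ω, D k ω)) ω := by
    intro ω
    by_cases h : searchAccepts P F test x₀ D ξ k ω
    · rw [indicator_of_mem (show ω ∈ {ω | searchAccepts P F test x₀ D ξ k ω} from h),
        searchState_succ_of_accepts h]
      simp only [lyapunov, SearchParams.accuracy, hφdef]
      field_simp
      ring
    · rw [indicator_of_notMem (show ω ∉ {ω | searchAccepts P F test x₀ D ξ k ω} from h),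
        searchState_succ_of_not_accepts h]
      simp only [lyapunov, SearchParams.accuracy]
      field_simp
      ring
  have hle : ∫ ω, acceptProb P F ρ test k (searchState P F test x₀ D ξ k ω, D k ω) *
      φ (searchState P F test x₀ D ξ k ω, D k ω) ∂μ ≤
      ∫ ω, P.accuracy (searchState P F test x₀ D ξ k ω).2 ∂μ := by
    refine integral_mono ?_ hacc fun ω => acceptProb_mul_le_accuracy hF ht k (stepSize_pos k ω)
    refine Integrable.mono hφi ?_ (.of_forall fun ω => ?_)
    · exact (((measurable_acceptProb hF ht k).mul hφ.measurable).comp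
        ((hR.measurable_searchState hF ht k).1.prodMk (hR.measurable_dir k))).aestronglyMeasurable
    · rw [norm_mul, Real.norm_eq_abs, abs_of_nonneg (acceptProb_nonneg _ _)]
      exact mul_le_of_le_one_left (norm_nonneg _) (acceptProb_le_one hF _ _)
  have hsum := integral_add (hV.sub (hacc.const_mul 2)) (hφi.indicator hA)
  have hsub := integral_sub hV (hacc.const_mul 2)
  rw [integral_const_mul] at hsub
  simp only [Pi.sub_apply] at hsum
  rw [integral_congr_ae (.of_forall hpath), hsum, hsub, integral_indicator hA, hstep]
  linarith

/-- The expected drops telescope, and `lyapunov` never falls below m. -/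
theorem IsSearchRun.sum_integral_sq_stepSize_le (hf : Continuous f)
    (hF : IsUnbiasedOracle f F ρ) (ht : test.IsAdmissible P F ρ)
    (hR : IsSearchRun P F ρ test x₀ D ξ μ) {m : ℝ} (hm : ∀ x, m ≤ f x) (K : ℕ) :
    ∑ k ∈ Finset.range K, ∫ ω, (searchState P F test x₀ D ξ k ω).2 ^ 2 ∂μ ≤
      ((P.γ ^ 2 - P.θ ^ 2) * (f x₀ - m) + P.c * P.δ₀ ^ 2) / (P.c / 2 * (1 - P.θ ^ 2)) := by
  have hq := P.sq_sub_sq_pos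
  have hq' := P.one_sub_sq_pos
  have hc := P.c_pos
  have h1 : ∀ K, ∑ k ∈ Finset.range K, ∫ ω, P.accuracy (searchState P F test x₀ D ξ k ω).2 ∂μ ≤
      lyapunov P f (x₀, P.δ₀) - ∫ ω, lyapunov P f (searchState P F test x₀ D ξ K ω) ∂μ := by
    intro K
    induction K with
    | zero => simp [searchState]
    | succ K ih =>
      rw [Finset.sum_range_succ]
      have := hR.integral_lyapunov_succ_le hf hF ht K
      linarith
  have h2 : m ≤ ∫ ω, lyapunov P f (searchState P F test x₀ D ξ K ω) ∂μ := by
    have := integral_mono (μ := μ) (integrable_const m)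
      (hR.integrable_comp hF ht K (continuous_lyapunov (P := P) hf)) fun ω => ?_
    · simpa using this
    · have h3 := hm (searchState P F test x₀ D ξ K ω).1
      have h4 : 0 ≤ P.c / (P.γ ^ 2 - P.θ ^ 2) * (searchState P F test x₀ D ξ K ω).2 ^ 2 := by
        positivity
      simp only [lyapunov]
      linarith
  have h3 := h1 K
  have h4 : ∀ k, ∫ ω, P.accuracy (searchState P F test x₀ D ξ k ω).2 ∂μ =
      P.c / 2 * (1 - P.θ ^ 2) / (P.γ ^ 2 - P.θ ^ 2) *
        ∫ ω, (searchState P F test x₀ D ξ k ω).2 ^ 2 ∂μ := by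
    intro k
    rw [← integral_const_mul]
    congr 1
    ext ω
    simp only [SearchParams.accuracy]
    field_simp
  simp only [h4] at h3
  rw [← Finset.mul_sum, div_mul_eq_mul_div, div_le_iff₀ hq] at h3
  rw [le_div_iff₀ (by positivity), mul_comm]
  refine h3.trans ?_
  have h5 : lyapunov P f (x₀, P.δ₀) * (P.γ ^ 2 - P.θ ^ 2) =
      (P.γ ^ 2 - P.θ ^ 2) * f x₀ + P.c * P.δ₀ ^ 2 := by
    simp only [lyapunov]
    field_simp
  nlinarith

end Lyapunov

/-! ### Drift of the log step size against visits above the threshold. -/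

/-- A multiplicative walk which moves up by `γ` on `A k` and down by `θ` otherwise, started above
`θ τ`: the gains of its logarithm while below `θ τ` are paid for by its visits above `θ τ`. -/
theorem sum_log_gain_le_visits {Ω : Type*} {γ θ τ d : ℝ} (hθ : 0 < θ) (hθ1 : θ < 1) (hγ : 1 < γ)
    (hτ : 0 < τ) (hd : d - Real.log γ ≤ Real.log θ) (hγθ : 0 ≤ Real.log γ + Real.log θ)
    {Δ : ℕ → Ω → ℝ} {A G : ℕ → Set Ω} (hpos : ∀ k ω, 0 < Δ k ω)
    (hup : ∀ k, ∀ ω ∈ A k, Δ (k + 1) ω = γ * Δ k ω)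
    (hdown : ∀ k, ∀ ω ∉ A k, Δ (k + 1) ω = θ * Δ k ω)
    (hG : Antitone G) {C : ℕ → Set Ω} (hC : ∀ k ω, ω ∈ C k ↔ θ * τ ≤ Δ k ω) (ω : Ω)
    (h0 : ω ∈ C 0) (K : ℕ) :
    ∑ k ∈ Finset.range K, ((G k ∩ C k).indicator (fun _ => d) ω +
      (G k \ C k).indicator (fun _ => Real.log θ) ω +
      ((G k \ C k) ∩ A k).indicator (fun _ => Real.log γ - Real.log θ) ω) ≤
    ∑ k ∈ Finset.range (K + 1), (C k).indicator (fun _ => Real.log γ) ω := by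
  classical
  have hlθ : Real.log θ < 0 := Real.log_neg hθ hθ1
  have hlγ : 0 < Real.log γ := Real.log_pos hγ
  set l : ℕ → ℝ := fun k => Real.log (Δ k ω) - Real.log τ
  -- The cap is where one upward step from level log θ leads. It is inactive for moves from below
  -- that level, and a capped value exceeds the starting value by at most log γ.
  set u : ℕ → ℝ := fun k => min (l k) (Real.log γ + Real.log θ)
  have hlC : ∀ k, ω ∈ C k ↔ Real.log θ ≤ l k := by
    intro k
    rw [hC, ← Real.log_le_log_iff (mul_pos hθ hτ) (hpos k ω), Real.log_mul hθ.ne' hτ.ne',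
      le_sub_iff_add_le]
  have hl1 : ∀ k, ω ∈ A k → l (k + 1) = l k + Real.log γ := by
    intro k hk
    simp only [l]
    rw [hup k ω hk, Real.log_mul (by positivity) (hpos k ω).ne']
    ring
  have hl2 : ∀ k, ω ∉ A k → l (k + 1) = l k + Real.log θ := by
    intro k hk
    simp only [l]
    rw [hdown k ω hk, Real.log_mul (by positivity) (hpos k ω).ne']
    ring
  have hind : ∀ k, 0 ≤ (C k).indicator (fun _ => Real.log γ) ω := fun k =>
    indicator_nonneg (fun _ _ => hlγ.le) ω
  have hfin : ∀ k, u k - u 0 ≤ (C k).indicator (fun _ => Real.log γ) ω := by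
    intro k
    have hu0 : Real.log θ ≤ u 0 := le_min ((hlC 0).1 h0) (by linarith)
    by_cases hk : ω ∈ C k
    · rw [indicator_of_mem hk]
      have : u k ≤ Real.log γ + Real.log θ := min_le_right _ _
      linarith
    · rw [indicator_of_notMem hk]
      have h1 : u k ≤ l k := min_le_left _ _
      have h2 := not_le.1 (mt (hlC k).2 hk)
      linarith
  -- Off `C k` the gain is the true increment of u. On `C k` the increment is at least log θ ≥ d -
  -- log γ, and the visit pays the missing log γ.
  have hstep : ∀ k, (G k ∩ C k).indicator (fun _ => d) ω +
      (G k \ C k).indicator (fun _ => Real.log θ) ω +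
      ((G k \ C k) ∩ A k).indicator (fun _ => Real.log γ - Real.log θ) ω ≤
      (if ω ∈ G k then u (k + 1) - u k else 0) + (C k).indicator (fun _ => Real.log γ) ω := by
    intro k
    by_cases hGk : ω ∈ G k
    · have hu : u k + Real.log θ ≤ u (k + 1) := by
        refine le_min ?_ ?_
        · have h1 : u k ≤ l k := min_le_left _ _
          by_cases hA : ω ∈ A k
          · rw [hl1 k hA]; linarith
          · rw [hl2 k hA]; linarith
        · have h1 : u k ≤ Real.log γ + Real.log θ := min_le_right _ _
          linarith
      by_cases hCk : ω ∈ C k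
      · simp only [Set.indicator, mem_inter_iff, mem_sdiff, hGk, hCk, not_true, and_false,
          and_self, if_true, if_false, false_and]
        linarith
      · have h2 := not_le.1 (mt (hlC k).2 hCk)
        have huk : u k = l k := min_eq_left (by linarith)
        by_cases hA : ω ∈ A k
        · have : u (k + 1) = l k + Real.log γ := by
            simp only [u]; rw [hl1 k hA]; exact min_eq_left (by linarith)
          simp only [Set.indicator, mem_inter_iff, mem_sdiff, hGk, hCk, hA, not_false_iff, and_false,
            and_self, if_true, if_false]
          linarith
        · simp only [Set.indicator, mem_inter_iff, mem_sdiff, hGk, hCk, hA, not_false_iff, and_false,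
            and_self, if_true, if_false]
          linarith
    · have := hind k
      simpa [Set.indicator, hGk] using this
  induction K with
  | zero => simpa using hind 0
  | succ K ih =>
    -- On `G K` all earlier `G k` hold too, so the increments telescope and the extra visit term at
    -- K + 1 absorbs the total. Off `G K` the new gain is zero.
    by_cases hGK : ω ∈ G K
    · have hsum := Finset.sum_le_sum fun k (_ : k ∈ Finset.range (K + 1)) => hstep k
      have htel : ∑ k ∈ Finset.range (K + 1), (if ω ∈ G k then u (k + 1) - u k else 0) =
          u (K + 1) - u 0 := by
        rw [← Finset.sum_range_sub u]
        refine Finset.sum_congr rfl fun k hk => if_pos ?_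
        exact hG (by have := Finset.mem_range.1 hk; omega) hGK
      rw [Finset.sum_add_distrib (f := fun k => if ω ∈ G k then u (k + 1) - u k else 0),
        htel] at hsum
      rw [Finset.sum_range_succ _ (K + 1)]
      have := hfin (K + 1)
      linarith
    · rw [Finset.sum_range_succ, Finset.sum_range_succ _ (K + 1)]
      have := hind (K + 1)
      have h0 : (G K ∩ C K).indicator (fun _ => d) ω +
          (G K \ C K).indicator (fun _ => Real.log θ) ω +
          ((G K \ C K) ∩ A K).indicator (fun _ => Real.log γ - Real.log θ) ω = 0 := by
        simp [Set.indicator, hGK]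
      linarith

/-- The hitting time counts the iterations k up to which ε has not been reached. -/
theorem hittingIteration_le_tsum {n : ℕ} {Ξ Ω : Type*} (P : SearchParams) (f : Vec n → ℝ)
    (F : Vec n → Ξ → ℝ) (test : TestRule n) (x₀ : Vec n) (D : ℕ → Ω → USphere n)
    (ξ : ℕ → Ω → ℕ → Ξ × Ξ) (ε : ℝ) (ω : Ω) :
    hittingIteration P f F test x₀ D ξ ε ω ≤ ∑' k : ℕ,
      {ω | ∀ j ≤ k, ε < ‖∇ f (searchState P F test x₀ D ξ j ω).1‖}.indicator 1 ω := by
  classical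
  by_cases h : ∃ k, ‖∇ f (searchState P F test x₀ D ξ k ω).1‖ ≤ ε
  · refine (iInf₂_le (Nat.find h) (Nat.find_spec h)).trans ?_
    refine le_trans (le_of_eq ?_) (ENNReal.sum_le_tsum (Finset.range (Nat.find h)))
    have hind : ∀ k ∈ Finset.range (Nat.find h),
        {ω | ∀ j ≤ k, ε < ‖∇ f (searchState P F test x₀ D ξ j ω).1‖}.indicator
          (1 : Ω → ℝ≥0∞) ω = 1 := by
      intro k hk
      have hmem : ω ∈ {ω | ∀ j ≤ k, ε < ‖∇ f (searchState P F test x₀ D ξ j ω).1‖} :=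
        fun j hj => not_le.1 (Nat.find_min h (lt_of_le_of_lt hj (Finset.mem_range.1 hk)))
      rw [indicator_of_mem hmem, Pi.one_apply]
    rw [Finset.sum_congr rfl hind, Finset.sum_const, Finset.card_range, nsmul_one]
  · push Not at h
    have hind : ∀ k : ℕ, {ω | ∀ j ≤ k, ε < ‖∇ f (searchState P F test x₀ D ξ j ω).1‖}.indicator
        (1 : Ω → ℝ≥0∞) ω = 1 := by
      intro k
      have hmem : ω ∈ {ω | ∀ j ≤ k, ε < ‖∇ f (searchState P F test x₀ D ξ j ω).1‖} :=
        fun j _ => h j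
      rw [indicator_of_mem hmem, Pi.one_apply]
    simp only [hind, ENNReal.tsum_const]
    simp

/-! ### Expected number of iterations before hitting. -/

section Hitting

variable {n : ℕ} {Ξ Ω : Type*} [MeasurableSpace Ξ] [MeasurableSpace Ω] {P : SearchParams}
  {f : Vec n → ℝ} {F : Vec n → Ξ → ℝ} {ρ : Measure Ξ} {test : TestRule n} {x₀ : Vec n}
  {D : ℕ → Ω → USphere n} {ξ : ℕ → Ω → ℕ → Ξ × Ξ} {μ : Measure Ω} [IsProbabilityMeasure μ]

theorem SearchParams.threshold_pos (P : SearchParams) (L : ℝ≥0) (hn : 0 < n) {ε : ℝ}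
    (hε : 0 < ε) : 0 < P.threshold L n ε := by
  have := P.c_pos
  have hn' : (0 : ℝ) < n := by exact_mod_cast hn
  unfold threshold
  positivity

theorem IsSearchRun.sum_measure_not_hit_le (hn : 0 < n)
    (hγθ : 0 < 3 * Real.log P.γ + 11 * Real.log P.θ)
    (hf : ContDiff ℝ 1 f) {L : ℝ≥0} (hL : LipschitzWith L (∇ f)) {m : ℝ} (hm : ∀ x, m ≤ f x)
    (hF : IsUnbiasedOracle f F ρ) (ht : test.IsAdmissible P F ρ)
    (hR : IsSearchRun P F ρ test x₀ D ξ μ) {ε : ℝ} (hε : 0 < ε)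
    (hδ : P.θ * P.threshold L n ε ≤ P.δ₀) (K : ℕ) :
    ∑ k ∈ Finset.range K,
      μ.real {ω | ∀ j ≤ k, ε < ‖∇ f (searchState P F test x₀ D ξ j ω).1‖} ≤
    14 * Real.log P.γ / (3 * Real.log P.γ + 11 * Real.log P.θ) *
      ((((P.γ ^ 2 - P.θ ^ 2) * (f x₀ - m) + P.c * P.δ₀ ^ 2) / (P.c / 2 * (1 - P.θ ^ 2))) /
        (P.θ * P.threshold L n ε) ^ 2) := by
  have hlθ : Real.log P.θ < 0 := Real.log_neg P.θ_pos P.θ_lt_one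
  have hlγ : 0 < Real.log P.γ := Real.log_pos P.one_lt_γ
  have hθ := P.θ_pos
  set τ := P.threshold L n ε
  have hτ : 0 < τ := P.threshold_pos L hn hε
  set d : ℝ := 3 / 14 * Real.log P.γ + 11 / 14 * Real.log P.θ with hd
  set G : ℕ → Set Ω := fun k => {ω | ∀ j ≤ k, ε < ‖∇ f (searchState P F test x₀ D ξ j ω).1‖}
    with hGdef
  set A : ℕ → Set Ω := fun k => {ω | searchAccepts P F test x₀ D ξ k ω}
  set C : ℕ → Set Ω := fun k => {ω | P.θ * τ ≤ (searchState P F test x₀ D ξ k ω).2}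
  have hg : Measurable (∇ f) := hL.continuous.measurable
  have hGm : ∀ k, MeasurableSet[pastSigma P F test x₀ D ξ k] (G k) := by
    intro k
    have : G k = ⋂ j, ⋂ (_ : j ≤ k),
        {ω | ε < ‖∇ f (searchState P F test x₀ D ξ j ω).1‖} := by
      ext ω; simp [hGdef]
    rw [this]
    refine MeasurableSet.iInter fun j => MeasurableSet.iInter fun hj => ?_
    refine pastSigma_mono hj _ ?_
    exact ((hg.comp measurable_fst).norm.comp (measurable_searchState_pastSigma j))
      measurableSet_Ioi
  have hCm : ∀ k, MeasurableSet[pastSigma P F test x₀ D ξ k] (C k) := fun k =>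
    (measurable_snd.comp (measurable_searchState_pastSigma k)) measurableSet_Ici
  have hle : ∀ k, pastSigma P F test x₀ D ξ k ≤ ‹MeasurableSpace Ω› := fun k =>
    le_sup_left.trans (hR.midSigma_le hF ht k)
  have hAm : ∀ k, MeasurableSet (A k) := fun k => (hR.measurable_searchState hF ht k).2
  have hGm' := fun k => hle k _ (hGm k)
  have hCm' := fun k => hle k _ (hCm k)
  have hGa : Antitone G := fun i j hij ω h k hk => h k (hk.trans hij)
  have hpath := fun ω => sum_log_gain_le_visits (Ω := Ω) hθ P.θ_lt_one P.one_lt_γ hτ (d := d)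
    (by linarith) (by linarith) (Δ := fun k ω => (searchState P F test x₀ D ξ k ω).2) (A := A)
    (G := G) (fun k ω => stepSize_pos k ω)
    (fun k ω h => by rw [searchState_succ_of_accepts h])
    (fun k ω h => by rw [searchState_succ_of_not_accepts h]) hGa (C := C) (fun k ω => Iff.rfl) ω
    hδ K
  have hic : ∀ {S : Set Ω} (_ : MeasurableSet S) (a : ℝ), Integrable (S.indicator fun _ => a) μ :=
    fun hS a => (integrable_const a).indicator hS
  have hia : ∀ {S : Set Ω} (_ : MeasurableSet S) (a : ℝ),
      ∫ ω, S.indicator (fun _ => a) ω ∂μ = μ.real S * a := by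
    intro S hS a
    rw [integral_indicator_const a hS, smul_eq_mul]
  have hmono := integral_mono (μ := μ) (integrable_finsetSum _ fun k _ =>
    ((hic ((hGm' k).inter (hCm' k)) d).add (hic ((hGm' k).diff (hCm' k)) (Real.log P.θ))).add
      (hic (((hGm' k).diff (hCm' k)).inter (hAm k)) (Real.log P.γ - Real.log P.θ)))
    (integrable_finsetSum _ fun k _ => hic (hCm' k) (Real.log P.γ)) hpath
  rw [integral_finsetSum _ fun k _ => hic (hCm' k) (Real.log P.γ),
    integral_finsetSum _ fun k _ =>
    ((hic ((hGm' k).inter (hCm' k)) d).add (hic ((hGm' k).diff (hCm' k)) (Real.log P.θ))).add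
      (hic (((hGm' k).diff (hCm' k)).inter (hAm k)) (Real.log P.γ - Real.log P.θ))] at hmono
  -- Below θτ the mean gain is at least log θ + (3/14)(log γ - log θ) = d. Above it, d is credited
  -- outright.
  have hlow : ∀ k, d * μ.real (G k) ≤ ∫ ω, ((G k ∩ C k).indicator (fun _ => d) ω +
      (G k \ C k).indicator (fun _ => Real.log P.θ) ω +
      ((G k \ C k) ∩ A k).indicator (fun _ => Real.log P.γ - Real.log P.θ) ω) ∂μ := by
    intro k
    have e1 := integral_add ((hic ((hGm' k).inter (hCm' k)) d).add
      (hic ((hGm' k).diff (hCm' k)) (Real.log P.θ)))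
      (hic (((hGm' k).diff (hCm' k)).inter (hAm k)) (Real.log P.γ - Real.log P.θ))
    have e2 := integral_add (hic ((hGm' k).inter (hCm' k)) d)
      (hic ((hGm' k).diff (hCm' k)) (Real.log P.θ))
    simp only [Pi.add_apply] at e1
    rw [e1, e2, hia ((hGm' k).inter (hCm' k)), hia ((hGm' k).diff (hCm' k)),
      hia (((hGm' k).diff (hCm' k)).inter (hAm k))]
    have h1 := hR.three_fourteenths_mul_le hn hf hL hF ht k (ε := ε)
      (MeasurableSet.diff (hGm k) (hCm k)) fun ω hω => ⟨(hω.1 k le_rfl).le, stepSize_pos k ω, by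
        have : (searchState P F test x₀ D ξ k ω).2 < P.θ * τ := not_le.1 hω.2
        exact this.le.trans (mul_le_of_le_one_left hτ.le P.θ_lt_one.le)⟩
    have h2 := measureReal_inter_add_sdiff (μ := μ) (s := G k) (hCm' k)
    have h3 := mul_le_mul_of_nonneg_right h1 (by linarith : 0 ≤ Real.log P.γ - Real.log P.θ)
    rw [← h2, hd]
    linarith
  -- Chebyshev's inequality for the step size.
  have hvis : ∀ k, (P.θ * τ) ^ 2 * μ.real (C k) ≤
      ∫ ω, (searchState P F test x₀ D ξ k ω).2 ^ 2 ∂μ := by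
    intro k
    rw [mul_comm, ← hia (hCm' k)]
    refine integral_mono (hic (hCm' k) _)
      (hR.integrable_comp hF ht k (φ := fun s => s.2 ^ 2) (by fun_prop)) fun ω => ?_
    by_cases h : ω ∈ C k
    · rw [indicator_of_mem h]
      exact pow_le_pow_left₀ (by positivity) h 2
    · rw [indicator_of_notMem h]
      positivity
  have hsum := hR.sum_integral_sq_stepSize_le hf.continuous hF ht hm (K + 1)
  have hvs := (Finset.sum_le_sum fun k (_ : k ∈ Finset.range (K + 1)) => hvis k).trans hsum
  have hlow' := (Finset.sum_le_sum fun k (_ : k ∈ Finset.range K) => hlow k).trans hmono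
  simp only [hia (hCm' _)] at hlow'
  rw [← Finset.mul_sum, ← Finset.sum_mul] at hlow'
  rw [← Finset.mul_sum, mul_comm, ← le_div_iff₀ (by positivity)] at hvs
  have hd0 : 0 < d := by rw [hd]; linarith
  have e : 14 * Real.log P.γ / (3 * Real.log P.γ + 11 * Real.log P.θ) = Real.log P.γ / d := by
    rw [div_eq_div_iff hγθ.ne' hd0.ne', hd]; ring
  rw [e, div_mul_eq_mul_div, le_div_iff₀ hd0]
  have := mul_le_mul_of_nonneg_left hvs hlγ.le
  linarith

end Hitting

section Monotonicity

variable {n : ℕ} {Ξ Ω : Type*} {P : SearchParams} {f : Vec n → ℝ} {F : Vec n → Ξ → ℝ}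
  {test : TestRule n} {x₀ : Vec n} {D : ℕ → Ω → USphere n} {ξ : ℕ → Ω → ℕ → Ξ × Ξ}

theorem hittingIteration_anti {ε ε' : ℝ} (h : ε' ≤ ε) (ω : Ω) :
    hittingIteration P f F test x₀ D ξ ε ω ≤ hittingIteration P f F test x₀ D ξ ε' ω :=
  iInf_mono fun _ => iInf_mono' fun hk => ⟨hk.trans h, le_rfl⟩

theorem hittingIteration_eq_zero {ε : ℝ} (h : ‖∇ f x₀‖ ≤ ε) (ω : Ω) :
    hittingIteration P f F test x₀ D ξ ε ω = 0 :=
  nonpos_iff_eq_zero.1 ((iInf₂_le 0 h).trans (by simp))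

end Monotonicity

section Expectation

variable {n : ℕ} {Ξ Ω : Type*} [MeasurableSpace Ξ] [MeasurableSpace Ω] {P : SearchParams}
  {f : Vec n → ℝ} {F : Vec n → Ξ → ℝ} {ρ : Measure Ξ} {test : TestRule n} {x₀ : Vec n}
  {D : ℕ → Ω → USphere n} {ξ : ℕ → Ω → ℕ → Ξ × Ξ} {μ : Measure Ω} [IsProbabilityMeasure μ]

theorem IsSearchRun.lintegral_hittingIteration_le (hn : 0 < n)
    (hγθ : 0 < 3 * Real.log P.γ + 11 * Real.log P.θ)
    (hf : ContDiff ℝ 1 f) {L : ℝ≥0} (hL : LipschitzWith L (∇ f)) {m : ℝ} (hm : ∀ x, m ≤ f x)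
    (hF : IsUnbiasedOracle f F ρ) (ht : test.IsAdmissible P F ρ)
    (hR : IsSearchRun P F ρ test x₀ D ξ μ) {ε : ℝ} (hε : 0 < ε)
    (hδ : P.θ * P.threshold L n ε ≤ P.δ₀) :
    ∫⁻ ω, hittingIteration P f F test x₀ D ξ ε ω ∂μ ≤ ENNReal.ofReal
      (14 * Real.log P.γ / (3 * Real.log P.γ + 11 * Real.log P.θ)
        * (((P.γ ^ 2 - P.θ ^ 2) * (f x₀ - m) + P.c * P.δ₀ ^ 2)
          / (P.c / 2 * (1 - P.θ ^ 2) * P.θ ^ 2))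
        * ((7 * (L : ℝ) + 14 * P.c) ^ 2 / 4) * (n / ε ^ 2)) := by
  have hg : Measurable (∇ f) := hL.continuous.measurable
  have hmeas : ∀ k, MeasurableSet
      {ω | ∀ j ≤ k, ε < ‖∇ f (searchState P F test x₀ D ξ j ω).1‖} := by
    intro k
    simp only [ofPred_forall]
    exact MeasurableSet.iInter fun j => MeasurableSet.iInter fun _ =>
      ((hg.comp measurable_fst).norm.comp (hR.measurable_searchState hF ht j).1) measurableSet_Ioi
  refine (lintegral_mono fun ω => hittingIteration_le_tsum P f F test x₀ D ξ ε ω).trans ?_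
  rw [lintegral_tsum fun k => (measurable_one.indicator (hmeas k)).aemeasurable]
  simp only [lintegral_indicator_one (hmeas _)]
  refine ENNReal.tsum_le_of_sum_range_le fun K => ?_
  have h := hR.sum_measure_not_hit_le hn hγθ hf hL hm hF ht hε hδ K
  rw [Finset.sum_congr rfl fun k _ => (ofReal_measureReal (μ := μ) (s :=
    {ω | ∀ j ≤ k, ε < ‖∇ f (searchState P F test x₀ D ξ j ω).1‖})).symm]
  rw [← ENNReal.ofReal_sum_of_nonneg fun _ _ => measureReal_nonneg]
  refine ENNReal.ofReal_le_ofReal (h.trans (le_of_eq ?_))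
  have hc := P.c_pos
  have hθ := P.θ_pos
  have hn' : (0 : ℝ) < n := by exact_mod_cast hn
  have hq := P.one_sub_sq_pos
  have hτ : P.threshold L n ε ^ 2 = 4 * ε ^ 2 / ((7 * (L : ℝ) + 14 * P.c) ^ 2 * n) := by
    rw [SearchParams.threshold, mul_pow, div_pow, div_pow, Real.sq_sqrt hn'.le]
    field_simp
    norm_num
  have : 7 * (L : ℝ) + 14 * P.c ≠ 0 := by positivity
  rw [mul_pow, hτ]
  field_simp

end Expectation

/-! ### The complexity bound, including large ε. -/

theorem theorem1 (P : SearchParams) (L : ℝ≥0)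
    (hγθ : 0 < 3 * Real.log P.γ + 11 * Real.log P.θ) (M : ℝ) :
    ∃ K : ℝ, ∀ (n : ℕ), 0 < n →
      ∀ (f : Vec n → ℝ) (fstar : ℝ), ContDiff ℝ 1 f → LipschitzWith L (∇ f) →
        (∀ x, fstar ≤ f x) →
      ∀ (Ξ : Type*) [MeasurableSpace Ξ] (F : Vec n → Ξ → ℝ) (ρ : Measure Ξ),
        IsUnbiasedOracle f F ρ →
      ∀ (test : TestRule n), test.IsAdmissible P F ρ →
      ∀ (x₀ : Vec n), f x₀ - fstar ≤ M →
      ∀ (Ω : Type*) [MeasurableSpace Ω] (μ : Measure Ω) [IsProbabilityMeasure μ]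
        (D : ℕ → Ω → USphere n) (ξ : ℕ → Ω → ℕ → Ξ × Ξ),
        IsSearchRun P F ρ test x₀ D ξ μ →
      ∀ (ε : ℝ), 0 < ε →
        (P.θ * P.threshold L n ε ≤ P.δ₀ →
          ∫⁻ ω, hittingIteration P f F test x₀ D ξ ε ω ∂μ ≤ ENNReal.ofReal
            (1 + 14 * Real.log P.γ / (3 * Real.log P.γ + 11 * Real.log P.θ)
              * (((P.γ ^ 2 - P.θ ^ 2) * (f x₀ - fstar) + P.c * P.δ₀ ^ 2)
                  / (P.c / 2 * (1 - P.θ ^ 2) * P.θ ^ 2))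
              * ((7 * (L : ℝ) + 14 * P.c) ^ 2 / 4) * (n / ε ^ 2))) ∧
        ∫⁻ ω, hittingIteration P f F test x₀ D ξ ε ω ∂μ ≤ ENNReal.ofReal (K * (n / ε ^ 2)) := by
  
  have hc := P.c_pos
  have hθ := P.θ_pos
  have hδ₀ := P.δ₀_pos
  have hq := P.one_sub_sq_pos
  have hq' := P.sq_sub_sq_pos
  have hlγ : 0 < Real.log P.γ := Real.log_pos P.one_lt_γ
  have hs : 0 < 7 * (L : ℝ) + 14 * P.c := by positivity
  set K₁ : ℝ := 14 * Real.log P.γ / (3 * Real.log P.γ + 11 * Real.log P.θ)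
    * (((P.γ ^ 2 - P.θ ^ 2) * M + P.c * P.δ₀ ^ 2) / (P.c / 2 * (1 - P.θ ^ 2) * P.θ ^ 2))
    * ((7 * (L : ℝ) + 14 * P.c) ^ 2 / 4) with hK₁
  -- the value of `n / ε²` at which `θ δ_ε = δ₀`
  set r : ℝ := (2 * P.θ / ((7 * (L : ℝ) + 14 * P.c) * P.δ₀)) ^ 2 with hr
  refine ⟨max K₁ (K₁ * r * (2 * L * M)), ?_⟩
  intro n hn f fstar hf hL hm Ξ _ F ρ hF test ht x₀ hM Ω _ μ _ D ξ hR ε hε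
  have hn' : (0 : ℝ) < n := by exact_mod_cast hn
  have hn1 : (1 : ℝ) ≤ n := by exact_mod_cast hn
  have hf0 : 0 ≤ f x₀ - fstar := sub_nonneg.2 (hm x₀)
  have hM0 : 0 ≤ M := hf0.trans hM
  have hK₁0 : 0 ≤ K₁ := by positivity
  have hbound : ∀ ε', 0 < ε' → P.θ * P.threshold L n ε' ≤ P.δ₀ →
      ∫⁻ ω, hittingIteration P f F test x₀ D ξ ε' ω ∂μ ≤ ENNReal.ofReal (K₁ * (n / ε' ^ 2)) := by
    intro ε' hε' hδ
    refine (hR.lintegral_hittingIteration_le hn hγθ hf hL hm hF ht hε' hδ).trans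
      (ENNReal.ofReal_le_ofReal ?_)
    rw [hK₁]
    gcongr
  refine ⟨fun hδ => ?_, ?_⟩
  · refine (hR.lintegral_hittingIteration_le hn hγθ hf hL hm hF ht hε hδ).trans
      (ENNReal.ofReal_le_ofReal ?_)
    -- The estimate already holds without the summand 1.
    linarith
  by_cases hδ : P.θ * P.threshold L n ε ≤ P.δ₀
  · refine (hbound ε hε hδ).trans (ENNReal.ofReal_le_ofReal ?_)
    gcongr
    exact le_max_left _ _
  by_cases hg : ‖∇ f x₀‖ ≤ ε
  · simp only [hittingIteration_eq_zero hg, lintegral_zero, zero_le]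
  -- Here ε is too large for (a) and T_ε is not trivially 0. The bound at ε₁ ≤ ε is the constant K₁
  -- r, which is at most a multiple of n/ε² because ε < ‖∇f(x₀)‖ bounds ε² by 2LM.
  set ε₁ : ℝ := (7 * (L : ℝ) + 14 * P.c) * P.δ₀ / (2 * P.θ) * √(n : ℝ) with hε₁
  have hε₁0 : 0 < ε₁ := by positivity
  have hδ₁ : P.θ * P.threshold L n ε₁ = P.δ₀ := by
    rw [SearchParams.threshold, hε₁]
    have : √(n : ℝ) ≠ 0 := (Real.sqrt_pos.2 hn').ne'
    field_simp
  have hε₁ε : ε₁ ≤ ε := by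
    by_contra! h
    refine hδ (le_trans ?_ hδ₁.le)
    unfold SearchParams.threshold
    gcongr
  refine (lintegral_mono fun ω => hittingIteration_anti hε₁ε ω).trans
    ((hbound ε₁ hε₁0 hδ₁.le).trans (ENNReal.ofReal_le_ofReal ?_))
  have e : (n : ℝ) / ε₁ ^ 2 = r := by
    rw [hε₁, hr, mul_pow, Real.sq_sqrt hn'.le]
    field_simp
  have hε2 : ε ^ 2 ≤ 2 * L * M := by
    calc ε ^ 2 ≤ ‖∇ f x₀‖ ^ 2 := pow_le_pow_left₀ hε.le (not_le.1 hg).le 2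
      _ ≤ 2 * L * (f x₀ - fstar) := norm_gradient_sq_le hf hL hm x₀
      _ ≤ 2 * L * M := by gcongr
  have h1 : 1 ≤ 2 * L * M * (n / ε ^ 2) := by
    rw [mul_div_assoc', one_le_div (by positivity)]
    nlinarith
  calc K₁ * (n / ε₁ ^ 2) = K₁ * r * 1 := by rw [e, mul_one]
    _ ≤ K₁ * r * (2 * L * M * (n / ε ^ 2)) := by gcongr
    _ = K₁ * r * (2 * L * M) * (n / ε ^ 2) := by ring
    _ ≤ _ := by gcongr; exact le_max_right _ _
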